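/- Write points of $\mathbb C^3$ as $(x,\mathbf y)=(x,y_1,y_2)$ and put $\|\mathbf y\|=\max(|y_1|,|y_2|)$. For $r>0$ and $\alpha<\beta$ let $S(r,\alpha,\beta)=\{x\in\mathbb C : 0<|x|<r,\ \alpha<\arg x<\beta\}$ (for some determination of $\arg x$). A sectorial neighborhood of the origin in the direction $\theta$ with opening $\eta$ is an open set $\mathcal S\subset\mathbb C^3$ containing $S(r,\theta-\frac{\eta}{2}-\epsilon,\theta+\frac{\eta}{2}+\epsilon)\times\mathbf D(0,\mathbf r)$ for some $r,\epsilon>0$ and some open polydisc $\mathbf D(0,\mathbf r)\subset\mathbb C^2$ of positive poly-radius centered at $0$. Denote by $\mathrm{Diff}_{\mathrm{fib}}(\mathcal S_{\theta,\eta};\mathrm{Id})$ the set of germs of biholomorphisms $\Phi:\mathcal S\to\Phi(\mathcal S)$, $\mathcal S$ such a neighborhood, of the form $\Phi(x,\mathbf y)=(x,\phi(x,\mathbf y))$ with $\Phi(x,\mathbf y)-(x,\mathbf y)=O(\|(x,\mathbf y)\|^2)$ as $(x,\mathbf y)\to 0$ in $\mathcal S$. Let $\lambda\in\mathbb C\setminus\{0\}$,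 let $a_1,a_2\in\mathbb C$ with $\mathrm{Re}(a_1+a_2)>0$, let $N\ge 1$ be an integer, and let $c$ be a germ of analytic function at $0\in\mathbb C$ with $c(0)=0$. Put $\vec{\mathcal C}=-y_1\partial_{y_1}+y_2\partial_{y_2}$, $\vec{\mathcal R}=y_1\partial_{y_1}+y_2\partial_{y_2}$ and $Y_0=\lambda\vec{\mathcal C}+x\,(x\partial_x+a_1y_1\partial_{y_1}+a_2y_2\partial_{y_2})$. Let $\eta\in\,]\pi,2\pi[$, and for each sign $\pm$ let $$Y_\pm^{(N+2)}=Y_0+\bigl(c(y_1y_2)+x^{N+2}D_\pm(x,\mathbf y)\bigr)\vec{\mathcal C}+x^{N+2}R_\pm(x,\mathbf y)\,\vec{\mathcal R},$$ where $D_\pm$ and $R_\pm$ are holomorphic in a sectorial neighborhood of the origin in the direction $\arg(\pm i\lambda)$ with opening $\eta$ and are of order at least one with respect to $\mathbf y$, in the sense that they are bounded there by a constant times $\|\mathbf y\|$. Then there exist $\Psi_+\in\mathrm{Diff}_{\mathrm{fib}}(\mathcal S_{\arg(i\lambda),\eta};\mathrm{Id})$ and $\Psi_-\in\mathrm{Diff}_{\mathrm{fib}}(\mathcal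 S_{\arg(-i\lambda),\eta};\mathrm{Id})$, of the form $\Psi_\pm(x,\mathbf y)=(x,\mathbf y+O(\|\mathbf y\|^2))$, which conjugate $Y_\pm^{(N+2)}$ to $$Y_{\mathrm{norm}}=x^2\partial_x+\bigl(-\lambda+a_1x-c(y_1y_2)\bigr)y_1\partial_{y_1}+\bigl(\lambda+a_2x+c(y_1y_2)\bigr)y_2\partial_{y_2},$$ i.e. $(\Psi_\pm)_*(Y_\pm^{(N+2)}):=(\mathrm D\Psi_\pm\cdot Y_\pm^{(N+2)})\circ\Psi_\pm^{-1}=Y_{\mathrm{norm}}$. Moreover $\Psi_\pm$ can be chosen such that $$\Psi_\pm(x,\mathbf y)=(x,\mathbf y)+x^N\,(0,P_{1,\pm}(x,\mathbf y),P_{2,\pm}(x,\mathbf y)),$$ where $P_{1,\pm},P_{2,\pm}$ are holomorphic in $S\bigl(r,\arg(\pm i\lambda)-\frac{\pi}{2}-\epsilon,\arg(\pm i\lambda)+\frac{\pi}{2}+\epsilon\bigr)\times\mathbf D(0,\mathbf r)$ for some $r>0$, some $\epsilon\in\,]0,\frac{\pi}{2}[$ with $\pi+2\epsilon>\eta$ and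 some polydisc $\mathbf D(0,\mathbf r)$, and are of order at least two with respect to $\mathbf y$, i.e. bounded there by a constant times $\|\mathbf y\|^2$. -/

import Mathlib

open Set Filter Topology Asymptotics

noncomputable section

namespace SaddleNode

/-- The phase space `ℂ³`, with points `p = (x, 𝐲) = (x, (y₁, y₂))`; thus `p.1 = x`, `p.2 = 𝐲`.
All norms on products are maximum norms, so `‖p.2‖ = max |y₁| |y₂|`. -/
abbrev Phase : Type := ℂ × ℂ × ℂ

/-- The open sector `S(r, α, β)`: all `x` with `0 < |x| < r` having an argument in `]α, β[`. -/
def sector (r α β : ℝ) : Set ℂ :=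
  {x | 0 < ‖x‖ ∧ ‖x‖ < r ∧ ∃ t ∈ Ioo α β, x = (‖x‖ : ℂ) * Complex.exp ((t : ℂ) * Complex.I)}

/-- The open polydisc of poly-radius `(ρ₁, ρ₂)` centred at the origin of `ℂ²`. -/
def polydisc (ρ₁ ρ₂ : ℝ) : Set (ℂ × ℂ) :=
  {y | ‖y.1‖ < ρ₁ ∧ ‖y.2‖ < ρ₂}

/-- `S` is a sectorial neighbourhood of the origin of `ℂ³` in the direction `θ` with
opening `η`. -/
def IsSectorialNhd (θ η : ℝ) (S : Set Phase) : Prop :=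
  IsOpen S ∧ ∃ r > 0, ∃ ρ₁ > 0, ∃ ρ₂ > 0, ∃ ε > 0,
    sector r (θ - η / 2 - ε) (θ + η / 2 + ε) ×ˢ polydisc ρ₁ ρ₂ ⊆ S

/-- `f` represents a germ of holomorphic function in a sectorial neighbourhood of the origin
in the direction `θ` with opening `η`, and is of order at least one with respect to `𝐲`,
i.e. dominated by `‖𝐲‖` there. -/
def IsSectorialRemainder (θ η : ℝ) (f : Phase → ℂ) : Prop :=
  ∃ S, IsSectorialNhd θ η S ∧ DifferentiableOn ℂ f S ∧
    ∃ L : ℝ, ∀ p ∈ S, ‖f p‖ ≤ L * ‖p.2‖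

/-- `Φ`, with domain `Φ.source` and image `Φ.target`, represents a germ of sectorial fibered
diffeomorphism in the direction `θ` with opening `η`, tangent to the identity. -/
structure IsSectorialDiffeo (θ η : ℝ) (Φ : OpenPartialHomeomorph Phase Phase) : Prop where
  source_mem : IsSectorialNhd θ η Φ.source
  holomorphic : DifferentiableOn ℂ Φ Φ.source
  holomorphic_symm : DifferentiableOn ℂ Φ.symm Φ.target
  fibered : ∀ p ∈ Φ.source, (Φ p).1 = p.1
  tangent_id : (fun p => Φ p - p) =O[𝓝[Φ.source] 0] fun p => ‖p‖ ^ 2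

/-- The push-forward `Φ_* Y = (DΦ · Y) ∘ Φ⁻¹`, meaningful on `Φ.target`. -/
def pushforward (Φ : OpenPartialHomeomorph Phase Phase) (Y : Phase → Phase) : Phase → Phase :=
  fun q => fderiv ℂ Φ (Φ.symm q) (Y (Φ.symm q))

/-- `𝒞 = -y₁ ∂/∂y₁ + y₂ ∂/∂y₂`. -/
def fieldC (p : Phase) : Phase := (0, -p.2.1, p.2.2)

/-- `ℛ = y₁ ∂/∂y₁ + y₂ ∂/∂y₂`. -/
def fieldR (p : Phase) : Phase := (0, p.2.1, p.2.2)

/-- `Y₀ = l 𝒞 + x (x ∂/∂x + a₁ y₁ ∂/∂y₁ + a₂ y₂ ∂/∂y₂)`. -/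
def fieldY₀ (l a₁ a₂ : ℂ) (p : Phase) : Phase :=
  l • fieldC p + p.1 • ((p.1, a₁ * p.2.1, a₂ * p.2.2) : Phase)

/-- The vector field normalized up to order `M`, with remainders `D` and `R`:
`Y₀ + (c(y₁y₂) + x^M D) 𝒞 + x^M R ℛ`. -/
def normalizedUpTo (M : ℕ) (l a₁ a₂ : ℂ) (c : ℂ → ℂ) (D R : Phase → ℂ) (p : Phase) : Phase :=
  fieldY₀ l a₁ a₂ p + (c (p.2.1 * p.2.2) + p.1 ^ M * D p) • fieldC p
    + (p.1 ^ M * R p) • fieldR p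

/-- The normal form
`x² ∂/∂x + (-l + a₁ x - c(y₁y₂)) y₁ ∂/∂y₁ + (l + a₂ x + c(y₁y₂)) y₂ ∂/∂y₂`. -/
def normalForm (l a₁ a₂ : ℂ) (c : ℂ → ℂ) (p : Phase) : Phase :=
  (p.1 ^ 2, (-l + a₁ * p.1 - c (p.2.1 * p.2.2)) * p.2.1,
    (l + a₂ * p.1 + c (p.2.1 * p.2.2)) * p.2.2)

/-- The direction `arg (± i l)`, the sign being `σ : ℤˣ`. -/
def direction (l : ℂ) (σ : ℤˣ) : ℝ :=
  Complex.arg (((σ : ℤ) : ℂ) * (Complex.I * l))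

/-- The sectors `S_±(r, ε)`, of opening `π + 2 ε` and bisected by `± i l`. -/
def wideSector (l : ℂ) (σ : ℤˣ) (r ε : ℝ) : Set ℂ :=
  sector r (direction l σ - Real.pi / 2 - ε) (direction l σ + Real.pi / 2 + ε)

end SaddleNode

end

/-! The conjugacy is sought as Ψ = (x, y₁ e^{χ₁}, y₂ e^{χ₂}) (`expMap`). With v = y₁y₂ and Y the
given field, Ψ carries Y to the normal form as soon as Yχ₁ = x^{N+2}(D − R) + c(v) − c(v e^{χ₁+χ₂})
and Yχ₂ = −x^{N+2}(D + R) − c(v) + c(v e^{χ₁+χ₂}). The nonlinear terms cancel in the sum: s = χ₁ +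
χ₂ solves the linear equation Ys = −2x^{N+2}R, and once s is known the equation for χ₁ is linear too
(`exists_exponents`). Each solution of a linear equation costs one power of x, whence x^{N+2} in the
data and x^N in the result.

To solve Yχ = f (`exists_homological`), put x = jlh with j = ±i and multiply Y by a unit
(`radialField_eq_smul`). The result is −h²G ∂_h + (−j − AhG + B₁) y₁ ∂_{y₁} + (j − AhG + B₂) y₂
∂_{y₂}, where A = (a₁ + a₂)/2, G is close to 1 and B₁, B₂ are O(h²). In real time τ ≥ 0, 1/h moves
approximately by 1/h + τ, so h tends to 0 like 1/τ even from sectors wider than a half-plane. The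
factors e^{±jτ} have modulus one, and (1 + τh)^{-A} stays bounded because Re A ≥ 0. So if f =
O(x^{m+2}‖y‖), the integral χ = −∫₀^∞ f ∘ Φ_τ dτ along the semiflow Φ converges, is holomorphic and
is O(x^{m+1}‖y‖).

The semiflow is built for all τ ≥ 0 at once, as a perturbation of the explicit flow with G = 1, B₁ =
B₂ = 0: the perturbation is a fixed point of `picardOperator`, which contracts by Cauchy's estimate.
Finally, Cauchy's estimate on a small polydisc makes Ψ − id a 1/2-Lipschitz map in each fibre, so Ψ
is biholomorphic onto its image (`exists_openPartialHomeomorph`). -/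

noncomputable section

namespace SaddleNode

open MeasureTheory Metric

/-! ### Cauchy estimates and their consequences in several variables -/

section SeveralVariables

variable {E F : Type*} [NormedAddCommGroup E] [NormedSpace ℂ E] [NormedAddCommGroup F]
  [NormedSpace ℂ F]

/-- Cauchy's estimate for the differential of a bounded holomorphic map on a ball. -/
theorem norm_fderiv_le_of_bounded {f : E → F} {c : E} {r M : ℝ} (hr : 0 < r)
    (hd : DifferentiableOn ℂ f (ball c r)) (hM : ∀ z ∈ ball c r, ‖f z‖ ≤ M) :
    ‖fderiv ℂ f c‖ ≤ 2 * M / r := by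
  refine Complex.norm_fderiv_le_div_of_mapsTo_ball hd (fun z hz => ?_) hr
  rw [mem_closedBall, dist_eq_norm]
  linarith [norm_sub_le (f z) (f c), hM z hz, hM c (mem_ball_self hr)]

/-- A bounded holomorphic map is Lipschitz on the concentric ball of half the radius. -/
theorem norm_sub_le_of_bounded {f : E → F} {c : E} {r M : ℝ} (hr : 0 < r)
    (hd : DifferentiableOn ℂ f (ball c (2 * r))) (hM : ∀ z ∈ ball c (2 * r), ‖f z‖ ≤ M)
    {x y : E} (hx : x ∈ closedBall c r) (hy : y ∈ closedBall c r) :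
    ‖f x - f y‖ ≤ 2 * M / r * ‖x - y‖ := by
  have hsub : ∀ z ∈ closedBall c r, ball z r ⊆ ball c (2 * r) := fun z hz =>
    ball_subset_ball' (by rw [mem_closedBall] at hz; linarith)
  let : NormedSpace ℝ E := NormedSpace.restrictScalars ℝ ℂ E
  refine (convex_closedBall c r).norm_image_sub_le_of_norm_fderiv_le (𝕜 := ℂ) (fun z hz => ?_)
    (fun z hz => ?_) hy hx
  · exact hd.differentiableAt (isOpen_ball.mem_nhds (hsub z hz (mem_ball_self hr)))
  · exact norm_fderiv_le_of_bounded hr (hd.mono (hsub z hz)) fun w hw => hM w (hsub z hz hw)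

theorem exists_ball_bounded {f : E → F} {U : Set E} (hU : IsOpen U) (hf : DifferentiableOn ℂ f U)
    {x : E} (hx : x ∈ U) : ∃ r > 0, ball x r ⊆ U ∧ ∃ M : ℝ, ∀ z ∈ ball x r, ‖f z‖ ≤ M := by
  have hc : ContinuousAt f x := (hf.differentiableAt (hU.mem_nhds hx)).continuousAt
  have h1 : ∀ᶠ z in 𝓝 x, ‖f z‖ < ‖f x‖ + 1 :=
    hc.norm.eventually_lt continuousAt_const (by linarith)
  obtain ⟨r, hr, hsub⟩ := Metric.mem_nhds_iff.1 (h1.and (hU.mem_nhds hx))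
  exact ⟨r, hr, fun z hz => (hsub hz).2, _, fun z hz => (hsub hz).1.le⟩

/-- A holomorphic map is strictly differentiable. -/
theorem hasStrictFDerivAt_of_differentiableOn {f : E → F} {U : Set E} (hU : IsOpen U)
    (hf : DifferentiableOn ℂ f U) {x : E} (hx : x ∈ U) :
    HasStrictFDerivAt f (fderiv ℂ f x) x := by
  obtain ⟨r, hr, hsub, M, hM⟩ := exists_ball_bounded hU hf hx
  have hda : ∀ z ∈ ball x r, DifferentiableAt ℂ f z := fun z hz =>
    hf.differentiableAt (hU.mem_nhds (hsub hz))
  refine hasStrictFDerivAt_of_hasFDerivAt_of_continuousAt (f' := fderiv ℂ f) ?_ ?_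
  · filter_upwards [ball_mem_nhds x hr] with z hz using (hda z hz).hasFDerivAt
  set t := r / 4 with ht
  have ht0 : 0 < t := by positivity
  refine continuousAt_of_locally_lipschitz ht0 (2 * (2 * M / (2 * t)) / t) fun y hy => ?_
  have hy' : ‖y - x‖ < t := by rwa [← dist_eq_norm]
  -- The derivative of f is Lipschitz near x: g is O(‖y − x‖) by the Lipschitz bound for f, so
  -- Cauchy's estimate bounds its differential, which is the difference of the differentials of f at
  -- y and x. With t = r/4, the ball of radius 2t and its double fit in the ball of radius r.
  set g : E → F := fun z => f (z + (y - x)) - f z with hg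
  have hmem : ∀ z ∈ ball x t, z + (y - x) ∈ closedBall x (2 * t) ∧ z ∈ closedBall x (2 * t) := by
    intro z hz
    rw [mem_ball, dist_eq_norm] at hz
    simp only [mem_closedBall, dist_eq_norm]
    refine ⟨?_, by linarith⟩
    have : z + (y - x) - x = (z - x) + (y - x) := by abel
    rw [this]
    linarith [norm_add_le (z - x) (y - x)]
  have hcb : closedBall x (2 * t) ⊆ ball x r := closedBall_subset_ball (by linarith)
  have hgd : ∀ z ∈ ball x t, HasFDerivAt g (fderiv ℂ f (z + (y - x)) - fderiv ℂ f z) z := by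
    intro z hz
    have h1 := (hda _ (hcb (hmem z hz).1)).hasFDerivAt
    have h2 : HasFDerivAt (fun w => f (w + (y - x))) (fderiv ℂ f (z + (y - x))) z :=
      h1.comp z ((hasFDerivAt_id z).add_const (y - x))
    exact h2.sub (hda _ (hcb (hmem z hz).2)).hasFDerivAt
  have hgb : ∀ z ∈ ball x t, ‖g z‖ ≤ 2 * M / (2 * t) * ‖y - x‖ := by
    intro z hz
    have := norm_sub_le_of_bounded (f := f) (c := x) (r := 2 * t) (M := M) (by positivity)
      (fun w hw => (hda w (ball_subset_ball (by linarith) hw)).differentiableWithinAt)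
      (fun w hw => hM w (ball_subset_ball (by linarith) hw)) (hmem z hz).1 (hmem z hz).2
    simpa using this
  have := norm_fderiv_le_of_bounded ht0
    (fun z hz => (hgd z hz).differentiableAt.differentiableWithinAt) hgb
  rw [(hgd x (mem_ball_self ht0)).fderiv] at this
  rw [dist_eq_norm, dist_eq_norm]
  have h2 : x + (y - x) = y := by abel
  rw [h2] at this
  refine this.trans (le_of_eq ?_)
  ring

theorem locallyLipschitzOn_of_differentiableOn {f : E → F} {U : Set E} (hU : IsOpen U)
    (hf : DifferentiableOn ℂ f U) : LocallyLipschitzOn U f := by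
  intro x hx
  obtain ⟨K, s, hs, hK⟩ := (hasStrictFDerivAt_of_differentiableOn hU hf hx).exists_lipschitzOnWith
  exact ⟨K, s, mem_nhdsWithin_of_mem_nhds hs, hK⟩

/-- A uniform limit of holomorphic maps is holomorphic. -/
theorem differentiableOn_of_tendstoUniformlyOn [CompleteSpace F] {f : ℕ → E → F} {g : E → F}
    {U : Set E} (hU : IsOpen U) (hf : ∀ n, DifferentiableOn ℂ (f n) U)
    (hlim : TendstoUniformlyOn f g atTop U) : DifferentiableOn ℂ g U := by
  intro x hx
  obtain ⟨r, hr, hsub⟩ := Metric.isOpen_iff.1 hU x hx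
  set t := r / 2 with ht
  have ht0 : 0 < t := by positivity
  have hb : ∀ y ∈ ball x t, ball y t ⊆ U := fun y hy =>
    (ball_subset_ball' (by rw [mem_ball] at hy; linarith)).trans hsub
  have hdiff : ∀ n, ∀ y ∈ ball x t, DifferentiableAt ℂ (f n) y := fun n y hy =>
    (hf n).differentiableAt (hU.mem_nhds (hb y hy (mem_ball_self ht0)))
  -- Cauchy's estimate applied to f m − f n transfers uniform convergence to the differentials.
  have hC : UniformCauchySeqOn (fun n => fderiv ℂ (f n)) atTop (ball x t) := by
    rw [Metric.uniformCauchySeqOn_iff]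
    intro ε hε
    obtain ⟨N, hN⟩ := Metric.uniformCauchySeqOn_iff.1 hlim.uniformCauchySeqOn (ε * t / 4)
      (by positivity)
    refine ⟨N, fun m hm n hn y hy => ?_⟩
    have h1 := norm_fderiv_le_of_bounded (f := fun z => f m z - f n z) (M := ε * t / 4) ht0
      (((hf m).sub (hf n)).mono (hb y hy)) fun z hz => by
        rw [← dist_eq_norm]; exact (hN m hm n hn z (hb y hy hz)).le
    rw [fderiv_fun_sub (hdiff m y hy) (hdiff n y hy)] at h1
    rw [dist_eq_norm]
    refine h1.trans_lt ?_
    rw [div_lt_iff₀ ht0]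
    nlinarith [mul_pos hε ht0]
  have hex : ∀ y ∈ ball x t, ∃ L, Tendsto (fun n => fderiv ℂ (f n) y) atTop (𝓝 L) := fun y hy =>
    cauchySeq_tendsto_of_complete (hC.cauchySeq hy)
  choose! L hL using hex
  exact (hasFDerivAt_of_tendstoUniformlyOn isOpen_ball (hC.tendstoUniformlyOn_of_tendsto hL)
    (fun n y hy => (hdiff n y hy).hasFDerivAt)
    (fun y hy => hlim.tendsto_at (hb y hy (mem_ball_self ht0)))
    (mem_ball_self ht0)).differentiableAt.differentiableWithinAt

/-- Holomorphic dependence on a parameter of a dominated integral. -/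
theorem differentiableOn_integral [FiniteDimensional ℂ E] [CompleteSpace F] {α : Type*}
    [MeasurableSpace α] {μ : Measure α} {f : E → α → F} {bound : α → ℝ} {U : Set E}
    (hU : IsOpen U) (hmeas : ∀ p ∈ U, AEStronglyMeasurable (f p) μ)
    (hd : ∀ᵐ a ∂μ, DifferentiableOn ℂ (fun p => f p a) U)
    (hb : ∀ᵐ a ∂μ, ∀ p ∈ U, ‖f p a‖ ≤ bound a) (hbi : Integrable bound μ) :
    DifferentiableOn ℂ (fun p => ∫ a, f p a ∂μ) U := by
  intro x hx
  obtain ⟨r, hr, hsub⟩ := Metric.isOpen_iff.1 hU x hx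
  set t := r / 2 with ht
  have ht0 : 0 < t := by positivity
  have h2t : 2 * t = r := by rw [ht]; ring
  -- In a finite basis the differential is determined by finitely many directional derivatives, each
  -- an almost everywhere limit of measurable difference quotients; the sequence starts at n₀ to
  -- keep the increments inside U.
  have hFmeas : AEStronglyMeasurable (fun a => fderiv ℂ (fun p => f p a) x) μ := by
    set b := Module.finBasis ℂ E
    have hexp : ∀ D : E →L[ℂ] F,
        D = ∑ i, ((b.coord i).toContinuousLinearMap).smulRight (D (b i)) := by
      intro D
      ext v
      simp only [FunLike.coe_sum, Finset.sum_apply, ContinuousLinearMap.smulRight_apply,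
        LinearMap.coe_toContinuousLinearMap', Module.Basis.coord_apply]
      conv_lhs => rw [← b.sum_repr v]
      rw [map_sum]
      exact Finset.sum_congr rfl fun i _ => by rw [map_smul]
    have hev : ∀ v : E, AEStronglyMeasurable (fun a => fderiv ℂ (fun p => f p a) x v) μ := by
      intro v
      have hlim : Tendsto (fun n : ℕ => x + ((n : ℂ) + 1)⁻¹ • v) atTop (𝓝 x) := by
        have h0 : Tendsto (fun n : ℕ => ((n : ℂ) + 1)⁻¹) atTop (𝓝 0) := by
          simpa [one_div] using tendsto_one_div_add_atTop_nhds_zero_nat (𝕜 := ℂ)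
        simpa using (h0.smul_const v).const_add x
      obtain ⟨n₀, hn₀⟩ := (hlim.eventually (hU.mem_nhds hx)).exists_forall_of_atTop
      refine aestronglyMeasurable_of_tendsto_ae atTop
        (f := fun (n : ℕ) a => (((n + n₀ : ℕ) : ℂ) + 1) •
          (f (x + (((n + n₀ : ℕ) : ℂ) + 1)⁻¹ • v) a - f x a)) (fun n => ?_) ?_
      · exact ((hmeas _ (hn₀ _ (by omega))).sub (hmeas x hx)).const_smul _
      · filter_upwards [hd] with a ha
        have hh := (ha.differentiableAt (hU.mem_nhds hx)).hasFDerivAt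
        refine hh.lim v (c := fun n : ℕ => (((n + n₀ : ℕ) : ℂ) + 1)) (l := atTop) ?_
        have h0 : Tendsto (fun n : ℕ => ‖((n : ℂ) + 1)‖) atTop atTop := by
          have : ∀ n : ℕ, ‖((n : ℂ) + 1)‖ = (n : ℝ) + 1 := fun n => by
            rw [show ((n : ℂ) + 1) = ((n + 1 : ℕ) : ℂ) by push_cast; ring, Complex.norm_natCast]
            push_cast; ring
          simp only [this]
          exact tendsto_atTop_add_const_right _ _ tendsto_natCast_atTop_atTop
        exact h0.comp (tendsto_add_atTop_nat n₀)
    have : (fun a => fderiv ℂ (fun p => f p a) x) = fun a =>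
        ∑ i, ((b.coord i).toContinuousLinearMap).smulRight (fderiv ℂ (fun p => f p a) x (b i)) :=
      funext fun a => hexp _
    rw [this]
    refine Finset.aestronglyMeasurable_fun_sum _ fun i _ => ?_
    exact (ContinuousLinearMap.smulRightL ℂ E F
      ((b.coord i).toContinuousLinearMap)).continuous.comp_aestronglyMeasurable (hev _)
  refine ((hasFDerivAt_integral_of_dominated_loc_of_lip' (𝕜 := ℂ)
    (bound := fun a => 2 * bound a / t) (ball_mem_nhds x ht0)
    (fun y hy => hmeas y (hsub (ball_subset_ball (by linarith) hy))) ?_ hFmeas ?_ ?_ ?_).2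
      ).differentiableAt.differentiableWithinAt
  · refine hbi.mono' (hmeas x hx) ?_
    filter_upwards [hb] with a ha using ha x hx
  · filter_upwards [hd, hb] with a ha hba y hy
    refine norm_sub_le_of_bounded (f := fun p => f p a) ht0 (ha.mono (h2t ▸ hsub))
      (fun z hz => hba z (hsub (h2t ▸ hz))) (ball_subset_closedBall hy)
      (mem_closedBall_self ht0.le)
  · simpa [div_eq_mul_inv] using (hbi.const_mul 2).mul_const t⁻¹
  · filter_upwards [hd] with a ha using (ha.differentiableAt (hU.mem_nhds hx)).hasFDerivAt

end SeveralVariables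

/-! ### Fixed points and primitives of holomorphic families of curves -/

section Picard

variable {E V : Type*} [NormedAddCommGroup E] [NormedSpace ℂ E] [NormedAddCommGroup V]
  [NormedSpace ℂ V]

/-- Families of curves `τ ↦ ξ τ p`, `τ ≥ 0`, depending holomorphically on `p ∈ Ω` and bounded
by `κ`. -/
structure IsHolomorphicFamily (Ω : Set E) (κ : ℝ) (ξ : ℝ → E → V) : Prop where
  continuousOn : ContinuousOn (fun q : ℝ × E => ξ q.1 q.2) (Ici 0 ×ˢ Ω)
  differentiableOn : ∀ τ ≥ 0, DifferentiableOn ℂ (ξ τ) Ω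
  bound : ∀ τ ≥ 0, ∀ p ∈ Ω, ‖ξ τ p‖ ≤ κ

/-- A contraction of the space of holomorphic families of curves has a fixed point. -/
theorem exists_fixedPoint_of_contraction [CompleteSpace V] {Ω : Set E} (hΩ : IsOpen Ω) {κ : ℝ}
    (hκ : 0 ≤ κ) (T : (ℝ → E → V) → ℝ → E → V)
    (hT : ∀ ξ, IsHolomorphicFamily Ω κ ξ → IsHolomorphicFamily Ω κ (T ξ))
    (hc : ∀ ξ ζ, IsHolomorphicFamily Ω κ ξ → IsHolomorphicFamily Ω κ ζ → ∀ d : ℝ,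
      (∀ τ ≥ 0, ∀ p ∈ Ω, ‖ξ τ p - ζ τ p‖ ≤ d) → ∀ τ ≥ 0, ∀ p ∈ Ω, ‖T ξ τ p - T ζ τ p‖ ≤ d / 2) :
    ∃ ξ, IsHolomorphicFamily Ω κ ξ ∧ ∀ τ ≥ 0, ∀ p ∈ Ω, T ξ τ p = ξ τ p := by
  -- Families are constrained only for τ ≥ 0 and p ∈ Ω, so the iteration is done by hand: the first
  -- gap is at most 2κ, later ones halve, and the uniform limit keeps continuity and holomorphy.
  set u : ℕ → ℝ → E → V := fun n => T^[n] 0 with hu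
  have hus : ∀ n, u (n + 1) = T (u n) := fun n => Function.iterate_succ_apply' _ _ _
  have hadm : ∀ n, IsHolomorphicFamily Ω κ (u n) := by
    intro n
    induction n with
    | zero =>
      exact ⟨continuousOn_const, fun _ _ => differentiableOn_const _, fun _ _ _ _ => by simpa [hu]⟩
    | succ n ih => rw [hus]; exact hT _ ih
  have hstep : ∀ n, ∀ τ ≥ 0, ∀ p ∈ Ω, ‖u n τ p - u (n + 1) τ p‖ ≤ 2 * κ / 2 ^ n := by
    intro n
    induction n with
    | zero =>
      intro τ hτ p hp
      have := norm_sub_le (u 0 τ p) (u 1 τ p)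
      simp only [zero_add, pow_zero, div_one]
      linarith [(hadm 0).bound τ hτ p hp, (hadm 1).bound τ hτ p hp]
    | succ n ih =>
      rw [hus n, hus (n + 1)]
      intro τ hτ p hp
      refine (hc _ _ (hadm n) (hadm (n + 1)) _ ih τ hτ p hp).trans (le_of_eq ?_)
      rw [pow_succ]; ring
  have hstep' : ∀ τ ≥ 0, ∀ p ∈ Ω, ∀ n, dist (u n τ p) (u (n + 1) τ p) ≤ 4 * κ / 2 / 2 ^ n := by
    intro τ hτ p hp n
    rw [dist_eq_norm]
    refine (hstep n τ hτ p hp).trans (le_of_eq ?_)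
    ring
  have hex : ∀ τ p, ∃ L, 0 ≤ τ → p ∈ Ω → Tendsto (fun n => u n τ p) atTop (𝓝 L) := by
    intro τ p
    by_cases h : 0 ≤ τ ∧ p ∈ Ω
    · obtain ⟨L, hL⟩ := cauchySeq_tendsto_of_complete
        (cauchySeq_of_le_geometric_two (hstep' τ h.1 p h.2))
      exact ⟨L, fun _ _ => hL⟩
    · exact ⟨0, fun h1 h2 => absurd ⟨h1, h2⟩ h⟩
  choose ξ hξ using hex
  have hdist : ∀ n, ∀ τ ≥ 0, ∀ p ∈ Ω, ‖u n τ p - ξ τ p‖ ≤ 4 * κ / 2 ^ n := fun n τ hτ p hp => by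
    rw [← dist_eq_norm]
    exact dist_le_of_le_geometric_two_of_tendsto (hstep' τ hτ p hp) (hξ τ p hτ hp) n
  have hsmall : Tendsto (fun n : ℕ => 4 * κ / 2 ^ n) atTop (𝓝 0) := by
    have := (tendsto_pow_atTop_nhds_zero_of_lt_one (r := (1 / 2 : ℝ)) (by norm_num)
      (by norm_num)).const_mul (4 * κ)
    simpa [div_eq_mul_inv] using this
  have hunif : TendstoUniformlyOn (fun n (q : ℝ × E) => u n q.1 q.2) (fun q => ξ q.1 q.2) atTop
      (Ici 0 ×ˢ Ω) := by
    rw [Metric.tendstoUniformlyOn_iff]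
    intro ε hε
    filter_upwards [hsmall.eventually_lt_const hε] with n hn q hq
    rw [dist_comm, dist_eq_norm]
    exact (hdist n q.1 hq.1 q.2 hq.2).trans_lt hn
  have hfam : IsHolomorphicFamily Ω κ ξ := by
    refine ⟨hunif.continuousOn (Frequently.of_forall fun n => (hadm n).continuousOn),
      fun τ hτ => ?_, fun τ hτ p hp => ?_⟩
    · refine differentiableOn_of_tendstoUniformlyOn hΩ (fun n => (hadm n).differentiableOn τ hτ) ?_
      rw [Metric.tendstoUniformlyOn_iff] at hunif ⊢
      intro ε hε
      filter_upwards [hunif ε hε] with n hn p hp using hn (τ, p) ⟨hτ, hp⟩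
    · exact le_of_tendsto (hξ τ p hτ hp).norm (Eventually.of_forall fun n =>
        (hadm n).bound τ hτ p hp)
  refine ⟨ξ, hfam, fun τ hτ p hp => ?_⟩
  refine tendsto_nhds_unique (f := fun n => u (n + 1) τ p) (l := atTop) ?_
    ((hξ τ p hτ hp).comp (tendsto_add_atTop_nat 1))
  rw [tendsto_iff_norm_sub_tendsto_zero]
  refine squeeze_zero (fun _ => norm_nonneg _) (fun n => ?_) (by simpa using hsmall.div_const 2)
  rw [hus]
  exact hc _ _ (hadm n) hfam _ (hdist n) τ hτ p hp

/-- The primitive in time of a bounded holomorphic family of curves. -/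
theorem IsHolomorphicFamily.primitive [FiniteDimensional ℂ E] [CompleteSpace V] {Ω : Set E}
    (hΩ : IsOpen Ω) {κ : ℝ} {ξ : ℝ → E → V} (h : IsHolomorphicFamily Ω κ ξ) :
    ContinuousOn (fun q : ℝ × E => ∫ s in (0 : ℝ)..q.1, ξ s q.2) (Ici 0 ×ˢ Ω) ∧
      ∀ τ ≥ 0, DifferentiableOn ℂ (fun p => ∫ s in (0 : ℝ)..τ, ξ s p) Ω := by
  have hcont : ∀ p ∈ Ω, ContinuousOn (fun s => ξ s p) (Ici 0) := fun p hp =>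
    h.continuousOn.comp (f := fun s : ℝ => (s, p)) (by fun_prop) fun s hs => ⟨hs, hp⟩
  have hdiff : ∀ τ ≥ 0, DifferentiableOn ℂ (fun p => ∫ s in (0 : ℝ)..τ, ξ s p) Ω := by
    intro τ hτ
    simp only [intervalIntegral.integral_of_le hτ]
    refine differentiableOn_integral (bound := fun _ => κ) hΩ (fun p hp => ?_) ?_ ?_ ?_
    · exact ((hcont p hp).mono (fun s hs => hs.1.le)).aestronglyMeasurable measurableSet_Ioc
    · filter_upwards [ae_restrict_mem measurableSet_Ioc] with s hs
      exact h.differentiableOn s hs.1.le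
    · filter_upwards [ae_restrict_mem measurableSet_Ioc] with s hs p hp
      exact h.bound s hs.1.le p hp
    · exact integrable_const _
  refine ⟨?_, hdiff⟩
  rintro ⟨τ₀, p₀⟩ ⟨hτ₀, hp₀⟩
  have hint : ∀ p ∈ Ω, ∀ a ≥ 0, ∀ b ≥ 0, IntervalIntegrable (fun s => ξ s p) volume a b :=
    fun p hp a ha b hb => ((hcont p hp).mono (fun s hs => by
      have : min a b ≤ s := hs.1
      exact (le_min ha hb).trans this)).intervalIntegrable
  have hc0 : ContinuousWithinAt (fun q : ℝ × E => ∫ s in (0 : ℝ)..τ₀, ξ s q.2) (Ici 0 ×ˢ Ω)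
      (τ₀, p₀) :=
    ContinuousWithinAt.comp (g := fun p => ∫ s in (0 : ℝ)..τ₀, ξ s p) (f := Prod.snd) (t := Ω)
      ((hdiff τ₀ hτ₀).continuousOn p₀ hp₀) continuous_snd.continuousWithinAt fun q hq => hq.2
  -- Joint continuity splits into continuity in p at the fixed time τ₀ and the bound κ|τ − τ₀|,
  -- uniform in p.
  have hc1 : Tendsto (fun q : ℝ × E => (∫ s in (0 : ℝ)..q.1, ξ s q.2) -
      ∫ s in (0 : ℝ)..τ₀, ξ s q.2) (𝓝[Ici 0 ×ˢ Ω] (τ₀, p₀)) (𝓝 0) := by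
    have hz : Tendsto (fun q : ℝ × E => κ * |q.1 - τ₀|) (𝓝[Ici 0 ×ˢ Ω] (τ₀, p₀)) (𝓝 0) := by
      have : Continuous fun q : ℝ × E => κ * |q.1 - τ₀| := by fun_prop
      have := this.tendsto (τ₀, p₀)
      simp only [sub_self, abs_zero, mul_zero] at this
      exact this.mono_left nhdsWithin_le_nhds
    refine squeeze_zero_norm' ?_ hz
    filter_upwards [self_mem_nhdsWithin] with q hq
    rw [intervalIntegral.integral_interval_sub_left (hint _ hq.2 _ le_rfl _ hq.1)
      (hint _ hq.2 _ le_rfl _ hτ₀)]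
    refine intervalIntegral.norm_integral_le_of_norm_le_const fun s hs => ?_
    have : min τ₀ q.1 < s := hs.1
    exact h.bound s ((le_min hτ₀ hq.1).trans this.le) q.2 hq.2
  have := hc1.add hc0
  simpa [ContinuousWithinAt] using this

end Picard

/-! ### Sectors and growth along the explicit flow -/

section Geometry

/-- The sector `0 < |h| < r`, `cos (arg h) > -γ`. -/
def cosSector (γ r : ℝ) : Set ℂ := {h | 0 < ‖h‖ ∧ ‖h‖ < r ∧ -γ * ‖h‖ < h.re}

/-- The product of `cosSector γ r` and of the polydisc of poly-radius `(ρ, ρ)`. -/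
def cosDomain (γ r ρ : ℝ) : Set Phase := {p | p.1 ∈ cosSector γ r ∧ ‖p.2‖ < ρ}

theorem isOpen_cosSector (γ r : ℝ) : IsOpen (cosSector γ r) := by
  have h1 : IsOpen {h : ℂ | 0 < ‖h‖} := isOpen_lt continuous_const continuous_norm
  have h2 : IsOpen {h : ℂ | ‖h‖ < r} := isOpen_lt continuous_norm continuous_const
  have h3 : IsOpen {h : ℂ | -γ * ‖h‖ < h.re} :=
    isOpen_lt (continuous_const.mul continuous_norm) Complex.continuous_re
  exact h1.inter (h2.inter h3)

theorem isOpen_cosDomain (γ r ρ : ℝ) : IsOpen (cosDomain γ r ρ) := by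
  have h1 : IsOpen {p : Phase | ‖p.2‖ < ρ} := isOpen_lt continuous_snd.norm continuous_const
  exact ((isOpen_cosSector γ r).preimage continuous_fst).inter h1

theorem cosSector_mono {γ γ' r r' : ℝ} (hγ : γ ≤ γ') (hr : r ≤ r') :
    cosSector γ r ⊆ cosSector γ' r' := by
  rintro h ⟨h1, h2, h3⟩
  exact ⟨h1, h2.trans_le hr, by nlinarith⟩

theorem cosDomain_mono {γ γ' r r' ρ ρ' : ℝ} (hγ : γ ≤ γ') (hr : r ≤ r') (hρ : ρ ≤ ρ') :
    cosDomain γ r ρ ⊆ cosDomain γ' r' ρ' :=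
  fun _ hp => ⟨cosSector_mono hγ hr hp.1, hp.2.trans_le hρ⟩

variable {γ r : ℝ} {h : ℂ}

theorem le_norm_one_add_mul (hγ : γ < 1) (hγ0 : 0 ≤ γ) (hh : h ∈ cosSector γ r) {τ : ℝ}
    (hτ : 0 ≤ τ) : (1 - γ) / 2 * (1 + τ * ‖h‖) ≤ ‖1 + τ * h‖ := by
  obtain ⟨h1, -, h3⟩ := hh
  have hsq : ‖1 + τ * h‖ ^ 2 = 1 + 2 * τ * h.re + (τ * ‖h‖) ^ 2 := by
    rw [mul_pow, ← Complex.normSq_eq_norm_sq, ← Complex.normSq_eq_norm_sq, Complex.normSq_apply,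
      Complex.normSq_apply]
    simp
    ring
  have ha : 0 ≤ τ * ‖h‖ := by positivity
  refine le_of_sq_le_sq ?_ (norm_nonneg _)
  rw [hsq]
  have h4 : -γ * (τ * ‖h‖) ≤ τ * h.re := by nlinarith
  set a := τ * ‖h‖
  -- The identity 1 − 2γa + a² = (1+γ)/2·(1−a)² + (1−γ)/2·(1+a)² is used, together with (1−γ)/2 ≥
  -- ((1−γ)/2)².
  nlinarith [mul_nonneg (by linarith : 0 ≤ 1 + γ) (sq_nonneg (1 - a)),
    mul_nonneg (mul_nonneg (by linarith : 0 ≤ 1 - γ) (by linarith : 0 ≤ 1 + γ))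
      (sq_nonneg (1 + a))]

/-- A sector with γ < 1 contains no negative real number, so the principal logarithm of 1 + τh is
available at all times. -/
theorem one_add_mul_mem_slitPlane (hγ : γ < 1) (hh : h ∈ cosSector γ r) {τ : ℝ}
    (hτ : 0 ≤ τ) : 1 + τ * h ∈ Complex.slitPlane := by
  obtain ⟨h1, -, h3⟩ := hh
  rw [Complex.mem_slitPlane_iff]
  by_contra hcon
  push Not at hcon
  simp only [Complex.add_re, Complex.one_re, Complex.mul_re, Complex.ofReal_re, Complex.ofReal_im,
    zero_mul, sub_zero, Complex.add_im, Complex.one_im, Complex.mul_im, add_zero, zero_add] at hcon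
  have hτ' : 0 < τ := hτ.lt_of_ne fun h => by rw [← h] at hcon; linarith [hcon.1]
  have him : h.im = 0 := by
    rcases mul_eq_zero.1 hcon.2 with h | h
    · exact absurd h hτ'.ne'
    · exact h
  have hre : h.re < 0 := by
    by_contra hge
    push Not at hge
    nlinarith [hcon.1, mul_nonneg hτ hge]
  have hn : ‖h‖ = -h.re := by
    rw [show h = (h.re : ℂ) from Complex.ext (by simp) (by simp [him])]
    simp [abs_of_neg hre]
  rw [hn] at h3
  nlinarith

theorem one_add_mem_slitPlane {z : ℂ} (hz : ‖z‖ ≤ 1 / 2) : 1 + z ∈ Complex.slitPlane :=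
  Complex.mem_slitPlane_of_norm_lt_one (by linarith)

theorem half_le_norm_one_add {z : ℂ} (hz : ‖z‖ ≤ 1 / 2) : 1 / 2 ≤ ‖1 + z‖ := by
  have := norm_sub_le (1 + z) z
  simp only [add_sub_cancel_right, norm_one] at this
  linarith

theorem norm_flow_fst_le (hγ : γ < 1) (hγ0 : 0 ≤ γ) (hh : h ∈ cosSector γ r) {τ : ℝ}
    (hτ : 0 ≤ τ) {ω : ℂ} (hω : ‖ω‖ ≤ 1 / 2) :
    ‖h / ((1 + τ * h) * (1 + ω))‖ ≤ 4 / (1 - γ) * (‖h‖ / (1 + τ * ‖h‖)) := by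
  have h1 := le_norm_one_add_mul hγ hγ0 hh hτ
  have h2 := half_le_norm_one_add hω
  have hpos : 0 < 1 + τ * ‖h‖ := by positivity
  have hγ' : 0 < 1 - γ := by linarith
  rw [norm_div, norm_mul]
  calc ‖h‖ / (‖1 + τ * h‖ * ‖1 + ω‖)
      ≤ ‖h‖ / ((1 - γ) / 2 * (1 + τ * ‖h‖) * (1 / 2)) := by gcongr
    _ = 4 / (1 - γ) * (‖h‖ / (1 + τ * ‖h‖)) := by field_simp; norm_num

theorem inv_mem_cosSector_iff {z : ℂ} (hz : z ≠ 0) : -γ * ‖z⁻¹‖ < z⁻¹.re ↔ -γ * ‖z‖ < z.re := by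
  have hn : 0 < ‖z‖ := norm_pos_iff.2 hz
  rw [Complex.inv_re, Complex.normSq_eq_norm_sq, norm_inv, lt_div_iff₀ (by positivity)]
  have : -γ * ‖z‖⁻¹ * ‖z‖ ^ 2 = -γ * ‖z‖ := by field_simp
  rw [this]

/-- In the coordinate k = 1/h the motion is k ↦ (k + τ)(1 + ω). Translation by τ ≥ 0 preserves Re k
> −γ|k|, and multiplication by 1 + ω opens the sector slightly; `hω1` says that γ + |ω| ≤ γ₁(1 −
|ω|), which absorbs this. -/
theorem flow_fst_mem_cosSector {γ₁ r₁ : ℝ} (hγ : γ < 1) (hγ0 : 0 ≤ γ)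
    (hh : h ∈ cosSector γ r) {τ : ℝ} (hτ : 0 ≤ τ) {ω : ℂ} (hω : ‖ω‖ ≤ 1 / 2)
    (hω1 : γ + ‖ω‖ * (1 + γ₁) ≤ γ₁) (hr : 4 / (1 - γ) * r ≤ r₁) :
    h / ((1 + τ * h) * (1 + ω)) ∈ cosSector γ₁ r₁ := by
  have hle := norm_flow_fst_le hγ hγ0 hh hτ hω
  have hs := Complex.slitPlane_ne_zero (one_add_mul_mem_slitPlane hγ hh hτ)
  have hs' := Complex.slitPlane_ne_zero (one_add_mem_slitPlane hω)
  obtain ⟨h1, h2, h3⟩ := hh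
  have hne : h ≠ 0 := norm_pos_iff.1 h1
  have hγ' : 0 < 1 - γ := by linarith
  refine ⟨norm_pos_iff.2 (div_ne_zero hne (mul_ne_zero hs hs')), ?_, ?_⟩
  · refine hle.trans_lt (lt_of_lt_of_le ?_ hr)
    gcongr
    refine (div_le_self h1.le ?_).trans_lt h2
    have : 0 ≤ τ * ‖h‖ := by positivity
    linarith
  · have hinv : h / ((1 + τ * h) * (1 + ω)) = ((h⁻¹ + τ) * (1 + ω))⁻¹ := by
      field_simp
    have hK : h⁻¹ + τ ≠ 0 := by
      intro h0
      apply hs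
      have : h * (h⁻¹ + τ) = 0 := by rw [h0, mul_zero]
      rw [mul_add, mul_inv_cancel₀ hne] at this
      rw [mul_comm (τ : ℂ)]
      exact this
    rw [hinv, inv_mem_cosSector_iff (mul_ne_zero hK hs')]
    have h4 := (inv_mem_cosSector_iff hne).2 h3
    set k := h⁻¹
    have hKre : -γ * ‖k + τ‖ < (k + τ).re := by
      have ht : ‖k‖ ≤ ‖k + τ‖ + τ := by
        have := norm_sub_le (k + τ) (τ : ℂ)
        simp only [add_sub_cancel_right, Complex.norm_real, Real.norm_eq_abs, abs_of_nonneg hτ]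
          at this
        exact this
      simp only [Complex.add_re, Complex.ofReal_re]
      nlinarith
    set K := k + τ
    have hre : K.re - ‖K‖ * ‖ω‖ ≤ (K * (1 + ω)).re := by
      have := Complex.abs_re_le_norm (K * ω)
      rw [norm_mul] at this
      rw [mul_add, mul_one, Complex.add_re K (K * ω)]
      linarith [neg_abs_le (K * ω).re]
    have hno : ‖K‖ * (1 - ‖ω‖) ≤ ‖K * (1 + ω)‖ := by
      rw [norm_mul]
      gcongr
      have := norm_sub_le (1 + ω) ω
      simp only [add_sub_cancel_right, norm_one] at this
      linarith
    have hγ₁ : 0 ≤ γ₁ := by nlinarith [norm_nonneg ω]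
    have hKn : 0 < ‖K‖ := norm_pos_iff.2 hK
    nlinarith [mul_le_mul_of_nonneg_left hno hγ₁, mul_le_mul_of_nonneg_left hω1 hKn.le]

/-- The exponent controlling the `𝐲`-coordinates along the flow. -/
def flowExponent (A : ℂ) (τ : ℝ) (h ω : ℂ) : ℂ :=
  A * (Complex.log (1 + τ * h) + Complex.log (1 + ω))

/-- A bound of the growth of the `𝐲`-coordinates along the flow. -/
def growthBound (γ : ℝ) (A : ℂ) : ℝ :=
  Real.exp (-A.re * Real.log ((1 - γ) / 2) + |A.im| * Real.pi + ‖A‖ + 1)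

/-- The sign of Re A enters here: Re(A log(1 + τh)) = Re A · log|1 + τh| − Im A · arg(1 + τh) is
bounded below uniformly in τ, since |1 + τh| ≥ (1−γ)/2 and the argument is at most π. -/
theorem norm_exp_flow_le {A : ℂ} (hA : 0 ≤ A.re) (hγ : γ < 1) (hγ0 : 0 ≤ γ)
    (hh : h ∈ cosSector γ r) {τ : ℝ} (hτ : 0 ≤ τ) {ω e j : ℂ} (hω : ‖ω‖ ≤ 1 / 2) (he : ‖e‖ ≤ 1)
    (hj : j.re = 0) :
    ‖Complex.exp (j * τ - flowExponent A τ h ω + e)‖ ≤ growthBound γ A := by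
  rw [Complex.norm_exp, growthBound, Real.exp_le_exp, flowExponent]
  have hγ' : 0 < (1 - γ) / 2 := by linarith
  have h1 : (1 - γ) / 2 ≤ ‖1 + τ * h‖ := by
    refine le_trans ?_ (le_norm_one_add_mul hγ hγ0 hh hτ)
    have : 0 ≤ τ * ‖h‖ := by positivity
    nlinarith
  have h2 : Real.log ((1 - γ) / 2) ≤ Real.log ‖1 + τ * h‖ := Real.log_le_log hγ' h1
  have h3 : ‖Complex.log (1 + ω)‖ ≤ 1 := by
    have := Complex.norm_log_one_add_half_le_self hω
    linarith
  have h4 : -‖A‖ ≤ (A * Complex.log (1 + ω)).re := by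
    have := Complex.abs_re_le_norm (A * Complex.log (1 + ω))
    rw [norm_mul] at this
    have h5 := mul_le_mul_of_nonneg_left h3 (norm_nonneg A)
    linarith [neg_abs_le (A * Complex.log (1 + ω)).re]
  have h6 : A.im * (1 + τ * h).arg ≤ |A.im| * Real.pi := by
    refine (le_abs_self _).trans ?_
    rw [abs_mul]
    gcongr
    exact Complex.abs_arg_le_pi _
  have h7 := (Complex.re_le_norm e).trans he
  rw [mul_add]
  simp only [Complex.add_re, Complex.sub_re]
  have h8 : (A * Complex.log (1 + τ * h)).re =
      A.re * Real.log ‖1 + τ * h‖ - A.im * (1 + τ * h).arg := by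
    rw [Complex.mul_re, Complex.log_re, Complex.log_im]
  have h9 : (j * (τ : ℂ)).re = 0 := by simp [hj]
  rw [h8, h9]
  nlinarith [mul_le_mul_of_nonneg_left h2 hA]

theorem growthBound_pos (γ : ℝ) (A : ℂ) : 0 < growthBound γ A := Real.exp_pos _

end Geometry

/-! ### The perturbed flow and its Picard operator -/

section Flow

/-- The perturbed position at time `τ` of the trajectory issued from `p`, the perturbation being
encoded by `ξ = (ω, e₁, e₂)`. -/
def flowMap (j A : ℂ) (τ : ℝ) (p ξ : Phase) : Phase :=
  (p.1 / ((1 + τ * p.1) * (1 + ξ.1)),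
    p.2.1 * Complex.exp (-j * τ - flowExponent A τ p.1 ξ.1 + ξ.2.1),
    p.2.2 * Complex.exp (j * τ - flowExponent A τ p.1 ξ.1 + ξ.2.2))

/-- The vector field `-h² G ∂_h + (-j - A h G + B₁) y₁ ∂_{y₁} + (j - A h G + B₂) y₂ ∂_{y₂}`. -/
def radialField (j A : ℂ) (G B₁ B₂ : Phase → ℂ) (p : Phase) : Phase :=
  (-p.1 ^ 2 * G p, p.2.1 * (-j - A * p.1 * G p + B₁ p), p.2.2 * (j - A * p.1 * G p + B₂ p))

variable {j A : ℂ} {γ₀ γ₁ r₀ r₁ ρ₀ ρ₁ κ : ℝ}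

theorem norm_flowMap_snd_le (hA : 0 ≤ A.re) (hj : j.re = 0) (hγ : γ₀ < 1) (hγ0 : 0 ≤ γ₀)
    {p : Phase} (hp : p.1 ∈ cosSector γ₀ r₀) {τ : ℝ} (hτ : 0 ≤ τ) {ξ : Phase}
    (hξ : ‖ξ‖ ≤ 1 / 2) : ‖(flowMap j A τ p ξ).2‖ ≤ growthBound γ₀ A * ‖p.2‖ := by
  have hω : ‖ξ.1‖ ≤ 1 / 2 := (norm_fst_le ξ).trans hξ
  have h2 : ‖ξ.2‖ ≤ 1 / 2 := (norm_snd_le ξ).trans hξ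
  have he1 : ‖ξ.2.1‖ ≤ 1 := by linarith [norm_fst_le ξ.2]
  have he2 : ‖ξ.2.2‖ ≤ 1 := by linarith [norm_snd_le ξ.2]
  have hg := (growthBound_pos γ₀ A).le
  refine norm_prod_le_iff.2 ⟨?_, ?_⟩
  · rw [flowMap, norm_mul, mul_comm]
    exact mul_le_mul (norm_exp_flow_le hA hγ hγ0 hp hτ hω he1 (by simp [hj])) (norm_fst_le p.2)
      (norm_nonneg _) hg
  · rw [flowMap, norm_mul, mul_comm]
    exact mul_le_mul (norm_exp_flow_le hA hγ hγ0 hp hτ hω he2 hj) (norm_snd_le p.2)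
      (norm_nonneg _) hg

theorem flowMap_mem_cosDomain (hA : 0 ≤ A.re) (hj : j.re = 0) (hγ : γ₀ < 1) (hγ0 : 0 ≤ γ₀)
    (hκ : κ ≤ 1 / 2) (hκ1 : γ₀ + κ * (1 + γ₁) ≤ γ₁) (hr : 4 / (1 - γ₀) * r₀ ≤ r₁)
    (hρ : growthBound γ₀ A * ρ₀ ≤ ρ₁) {p : Phase} (hp : p ∈ cosDomain γ₀ r₀ ρ₀) {τ : ℝ}
    (hτ : 0 ≤ τ) {ξ : Phase} (hξ : ‖ξ‖ ≤ κ) : flowMap j A τ p ξ ∈ cosDomain γ₁ r₁ ρ₁ := by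
  have hω : ‖ξ.1‖ ≤ κ := (norm_fst_le ξ).trans hξ
  have hω0 := norm_nonneg ξ.1
  refine ⟨flow_fst_mem_cosSector hγ hγ0 hp.1 hτ (hω.trans hκ) ?_ hr, ?_⟩
  · by_cases h : 0 ≤ 1 + γ₁
    · nlinarith
    · push Not at h
      nlinarith
  · refine (norm_flowMap_snd_le hA hj hγ hγ0 hp.1 hτ (hξ.trans hκ)).trans_lt (lt_of_lt_of_le ?_ hρ)
    exact mul_lt_mul_of_pos_left hp.2 (growthBound_pos _ _)

theorem differentiableAt_flowMap {τ : ℝ} {q : Phase × Phase}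
    (h1 : 1 + τ * q.1.1 ∈ Complex.slitPlane) (h2 : 1 + q.2.1 ∈ Complex.slitPlane) :
    DifferentiableAt ℂ (fun q : Phase × Phase => flowMap j A τ q.1 q.2) q := by
  have hne : (1 + τ * q.1.1) * (1 + q.2.1) ≠ 0 :=
    mul_ne_zero (Complex.slitPlane_ne_zero h1) (Complex.slitPlane_ne_zero h2)
  have hL : DifferentiableAt ℂ (fun q : Phase × Phase => flowExponent A τ q.1.1 q.2.1) q := by
    unfold flowExponent
    have g1 : DifferentiableAt ℂ (fun q : Phase × Phase => Complex.log (1 + τ * q.1.1)) q :=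
      DifferentiableAt.clog (f := fun q : Phase × Phase => 1 + τ * q.1.1) (by fun_prop) h1
    have g2 : DifferentiableAt ℂ (fun q : Phase × Phase => Complex.log (1 + q.2.1)) q :=
      DifferentiableAt.clog (f := fun q : Phase × Phase => 1 + q.2.1) (by fun_prop) h2
    fun_prop
  unfold flowMap
  refine DifferentiableAt.prodMk ?_ (DifferentiableAt.prodMk ?_ ?_)
  · simp only [div_eq_mul_inv]
    exact DifferentiableAt.fun_mul (by fun_prop) (DifferentiableAt.fun_inv
      (h := fun q : Phase × Phase => (1 + τ * q.1.1) * (1 + q.2.1)) (by fun_prop) hne)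
  · fun_prop
  · fun_prop

theorem continuousAt_flowMap {q : ℝ × Phase × Phase}
    (h1 : 1 + q.1 * q.2.1.1 ∈ Complex.slitPlane) (h2 : 1 + q.2.2.1 ∈ Complex.slitPlane) :
    ContinuousAt (fun q : ℝ × Phase × Phase => flowMap j A q.1 q.2.1 q.2.2) q := by
  have hne : (1 + q.1 * q.2.1.1) * (1 + q.2.2.1) ≠ 0 :=
    mul_ne_zero (Complex.slitPlane_ne_zero h1) (Complex.slitPlane_ne_zero h2)
  have hL : ContinuousAt (fun q : ℝ × Phase × Phase => flowExponent A q.1 q.2.1.1 q.2.2.1) q := by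
    unfold flowExponent
    have g1 : ContinuousAt (fun q : ℝ × Phase × Phase => Complex.log (1 + q.1 * q.2.1.1)) q :=
      ContinuousAt.clog (f := fun q : ℝ × Phase × Phase => 1 + (q.1 : ℂ) * q.2.1.1)
        (by fun_prop) h1
    have g2 : ContinuousAt (fun q : ℝ × Phase × Phase => Complex.log (1 + q.2.2.1)) q :=
      ContinuousAt.clog (f := fun q : ℝ × Phase × Phase => 1 + q.2.2.1) (by fun_prop) h2
    fun_prop
  unfold flowMap
  refine ContinuousAt.prodMk ?_ (ContinuousAt.prodMk ?_ ?_)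
  · exact ContinuousAt.div (by fun_prop) (by fun_prop) hne
  · fun_prop
  · fun_prop

theorem isHolomorphicFamily_flowMap (hA : 0 ≤ A.re) (hj : j.re = 0) (hγ : γ₀ < 1) (hγ0 : 0 ≤ γ₀)
    (hκ : κ ≤ 1 / 2) (hκ1 : γ₀ + κ * (1 + γ₁) ≤ γ₁) (hr : 4 / (1 - γ₀) * r₀ ≤ r₁)
    (hρ : growthBound γ₀ A * ρ₀ ≤ ρ₁) {ξ : ℝ → Phase → Phase}
    (hξ : IsHolomorphicFamily (cosDomain γ₀ r₀ ρ₀) κ ξ) :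
    IsHolomorphicFamily (cosDomain γ₀ r₀ ρ₀) (max r₁ ρ₁) fun s p => flowMap j A s p (ξ s p) := by
  have hsl : ∀ s ≥ 0, ∀ p ∈ cosDomain γ₀ r₀ ρ₀, 1 + (ξ s p).1 ∈ Complex.slitPlane :=
    fun s hs p hp => one_add_mem_slitPlane
      (((norm_fst_le _).trans (hξ.bound s hs p hp)).trans hκ)
  refine ⟨?_, fun s hs => ?_, fun s hs p hp => ?_⟩
  · intro q hq
    exact ContinuousAt.comp_continuousWithinAt (f := fun q : ℝ × Phase => (q.1, q.2, ξ q.1 q.2))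
      (continuousAt_flowMap (one_add_mul_mem_slitPlane hγ hq.2.1 hq.1) (hsl _ hq.1 _ hq.2))
      (continuous_fst.continuousWithinAt.prodMk
        (continuous_snd.continuousWithinAt.prodMk (hξ.continuousOn q hq)))
  · intro p hp
    exact DifferentiableAt.comp_differentiableWithinAt (f := fun p : Phase => (p, ξ s p)) p
      (differentiableAt_flowMap (one_add_mul_mem_slitPlane hγ hp.1 hs) (hsl s hs p hp))
      (differentiableWithinAt_id.prodMk (hξ.differentiableOn s hs p hp))
  · obtain ⟨h1, h2⟩ := flowMap_mem_cosDomain hA hj hγ hγ0 hκ hκ1 hr hρ hp hs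
      (hξ.bound s hs p hp)
    exact norm_prod_le_iff.2 ⟨h1.2.1.le.trans (le_max_left _ _), h2.le.trans (le_max_right _ _)⟩

theorem IsHolomorphicFamily.comp {Ω U : Set Phase} {φ : Phase → ℂ} {C κ : ℝ}
    {ξ : ℝ → Phase → Phase} (hξ : IsHolomorphicFamily Ω κ ξ) (hφ : DifferentiableOn ℂ φ U)
    (hC : ∀ p ∈ U, ‖φ p‖ ≤ C) (hm : ∀ s ≥ 0, ∀ p ∈ Ω, ξ s p ∈ U) :
    IsHolomorphicFamily Ω C fun s p => φ (ξ s p) :=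
  ⟨hφ.continuousOn.comp hξ.continuousOn fun _ hq => hm _ hq.1 _ hq.2,
    fun s hs => hφ.comp (hξ.differentiableOn s hs) fun p hp => hm s hs p hp,
    fun s hs p hp => hC _ (hm s hs p hp)⟩

/-- With a = |h| at time 0, the weight bounds |h|² along a trajectory up to a constant. Its total
mass a shows that integrating an O(h²) quantity over all times costs exactly one power of h. -/
theorem integral_weight {a : ℝ} (ha : 0 < a) :
    IntegrableOn (fun s : ℝ => (a / (1 + s * a)) ^ 2) (Ioi 0) ∧
      ∫ s in Ioi (0 : ℝ), (a / (1 + s * a)) ^ 2 = a := by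
  have hd : ∀ s ∈ Ici (0 : ℝ),
      HasDerivAt (fun s : ℝ => -(a / (1 + s * a))) ((a / (1 + s * a)) ^ 2) s := by
    intro s hs
    have hne : 1 + s * a ≠ 0 := by
      have : 0 ≤ s * a := mul_nonneg hs ha.le
      linarith
    have h1 : HasDerivAt (fun s : ℝ => 1 + s * a) a s := by
      simpa using ((hasDerivAt_id s).mul_const a).const_add 1
    refine ((hasDerivAt_const s a).fun_div h1 hne).fun_neg.congr_deriv ?_
    rw [div_pow]
    ring
  have hlim : Tendsto (fun s : ℝ => -(a / (1 + s * a))) atTop (𝓝 0) := by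
    have h1 : Tendsto (fun s : ℝ => 1 + s * a) atTop atTop :=
      tendsto_atTop_add_const_left _ _ (tendsto_id.atTop_mul_const ha)
    simpa using (h1.const_div_atTop a).neg
  refine ⟨integrableOn_Ioi_deriv_of_nonneg' hd (fun s _ => by positivity) hlim, ?_⟩
  rw [integral_Ioi_of_hasDerivAt_of_nonneg' hd (fun s _ => by positivity) hlim]
  simp

theorem norm_setIntegral_le_of_weight {f : ℝ → ℂ} {a M : ℝ} (ha : 0 < a) (hM : 0 ≤ M)
    {S : Set ℝ} (hS : MeasurableSet S) (hS0 : S ⊆ Ioi 0)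
    (hf : ∀ s ∈ S, ‖f s‖ ≤ M * (a / (1 + s * a)) ^ 2) : ‖∫ s in S, f s‖ ≤ M * a := by
  obtain ⟨h1, h2⟩ := integral_weight ha
  have h1' : IntegrableOn (fun s : ℝ => M * (a / (1 + s * a)) ^ 2) (Ioi 0) := h1.const_mul M
  refine (norm_integral_le_of_norm_le (h1'.mono_set hS0) ?_).trans ?_
  · filter_upwards [ae_restrict_mem hS] with s hs using hf s hs
  · refine (setIntegral_mono_set h1' ?_ hS0.eventuallyLE).trans (le_of_eq ?_)
    · exact Eventually.of_forall fun s => by positivity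
    · rw [integral_const_mul, h2]

/-- The hypotheses on the coefficients of `radialField`. -/
structure IsRadialData (γ r ρ δ C : ℝ) (G B₁ B₂ : Phase → ℂ) : Prop where
  diffG : DifferentiableOn ℂ G (cosDomain γ r ρ)
  diffB₁ : DifferentiableOn ℂ B₁ (cosDomain γ r ρ)
  diffB₂ : DifferentiableOn ℂ B₂ (cosDomain γ r ρ)
  boundG : ∀ p ∈ cosDomain γ r ρ, ‖G p - 1‖ ≤ δ
  boundB₁ : ∀ p ∈ cosDomain γ r ρ, ‖B₁ p‖ ≤ C * ‖p.1‖ ^ 2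
  boundB₂ : ∀ p ∈ cosDomain γ r ρ, ‖B₂ p‖ ≤ C * ‖p.1‖ ^ 2

/-- The operator whose fixed point encodes the flow of `radialField`. -/
def picardOperator (j A : ℂ) (G B₁ B₂ : Phase → ℂ) (ξ : ℝ → Phase → Phase) (τ : ℝ) (p : Phase) :
    Phase :=
  (p.1 / (1 + τ * p.1) * ∫ s in (0 : ℝ)..τ, (G (flowMap j A s p (ξ s p)) - 1),
    ∫ s in (0 : ℝ)..τ, B₁ (flowMap j A s p (ξ s p)),
    ∫ s in (0 : ℝ)..τ, B₂ (flowMap j A s p (ξ s p)))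

/-- The integrand G − 1 is small but need not be integrable over infinite time; the growth δτ of its
integral is compensated by the prefactor h/(1 + τh), because τ|h|/(1 + τ|h|) ≤ 1. -/
theorem norm_div_mul_integral_le (hγ : γ₀ < 1) (hγ0 : 0 ≤ γ₀) {h : ℂ}
    (hh : h ∈ cosSector γ₀ r₀) {τ δ : ℝ} (hτ : 0 ≤ τ) {f : ℝ → ℂ}
    (hf : ∀ s ∈ Ioc 0 τ, ‖f s‖ ≤ δ) (hδ : 0 ≤ δ) :
    ‖h / (1 + τ * h) * ∫ s in (0 : ℝ)..τ, f s‖ ≤ 2 / (1 - γ₀) * δ := by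
  have h1 := le_norm_one_add_mul hγ hγ0 hh hτ
  have h2 : ‖∫ s in (0 : ℝ)..τ, f s‖ ≤ δ * τ := by
    have := intervalIntegral.norm_integral_le_of_norm_le_const (f := f) (a := 0) (b := τ) (C := δ)
      (by rwa [uIoc_of_le hτ])
    rwa [sub_zero, abs_of_nonneg hτ] at this
  have hn : 0 ≤ τ * ‖h‖ := by positivity
  have hγ' : 0 < 1 - γ₀ := by linarith
  rw [norm_mul, norm_div]
  calc ‖h‖ / ‖1 + τ * h‖ * ‖∫ s in (0 : ℝ)..τ, f s‖
      ≤ ‖h‖ / ((1 - γ₀) / 2 * (1 + τ * ‖h‖)) * (δ * τ) := by gcongr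
    _ = 2 / (1 - γ₀) * δ * (τ * ‖h‖ / (1 + τ * ‖h‖)) := by field_simp
    _ ≤ 2 / (1 - γ₀) * δ * 1 := by
        gcongr
        rw [div_le_one (by positivity)]
        linarith
    _ = _ := mul_one _

end Flow

/-! ### Contraction property of the Picard operator -/

section FlowExistence

variable {j A : ℂ} {γ₀ γ₁ r₀ r₁ ρ₀ ρ₁ κ δ C : ℝ} {G B₁ B₂ : Phase → ℂ}

/-- Constants for which the fixed point problem for the flow is contracting. -/
structure IsFlowConstants (A : ℂ) (γ₀ γ₁ r₀ r₁ ρ₀ ρ₁ κ δ C : ℝ) : Prop where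
  γ₀_nonneg : 0 ≤ γ₀
  γ₀_lt : γ₀ < 1
  A_nonneg : 0 ≤ A.re
  κ_pos : 0 < κ
  κ_le : 2 * κ ≤ 1 / 2
  κ_angle : γ₀ + 2 * κ * (1 + γ₁) ≤ γ₁
  radius : 4 / (1 - γ₀) * r₀ ≤ r₁
  polyradius : growthBound γ₀ A * ρ₀ ≤ ρ₁
  δ_nonneg : 0 ≤ δ
  δ_le : 2 / (1 - γ₀) * δ ≤ κ / 4
  C_nonneg : 0 ≤ C
  C_le : C * (4 / (1 - γ₀)) ^ 2 * r₀ ≤ κ / 4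

theorem IsFlowConstants.flowMap_mem
    (hk : IsFlowConstants A γ₀ γ₁ r₀ r₁ ρ₀ ρ₁ κ δ C) (hj : j.re = 0)
    {p : Phase} (hp : p ∈ cosDomain γ₀ r₀ ρ₀) {τ : ℝ}
    (hτ : 0 ≤ τ) {ξ : Phase} (hξ : ‖ξ‖ ≤ 2 * κ) : flowMap j A τ p ξ ∈ cosDomain γ₁ r₁ ρ₁ :=
  flowMap_mem_cosDomain hk.A_nonneg hj hk.γ₀_lt hk.γ₀_nonneg hk.κ_le hk.κ_angle hk.radius
    hk.polyradius hp hτ hξ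

theorem IsFlowConstants.family
    (hk : IsFlowConstants A γ₀ γ₁ r₀ r₁ ρ₀ ρ₁ κ δ C) (hj : j.re = 0)
    {ξ : ℝ → Phase → Phase}
    (hξ : IsHolomorphicFamily (cosDomain γ₀ r₀ ρ₀) κ ξ) {φ : Phase → ℂ} {M : ℝ}
    (hφ : DifferentiableOn ℂ φ (cosDomain γ₁ r₁ ρ₁)) (hM : ∀ p ∈ cosDomain γ₁ r₁ ρ₁, ‖φ p‖ ≤ M) :
    IsHolomorphicFamily (cosDomain γ₀ r₀ ρ₀) M fun s p => φ (flowMap j A s p (ξ s p)) := by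
  have hκ := hk.κ_pos
  have hξ' : IsHolomorphicFamily (cosDomain γ₀ r₀ ρ₀) (2 * κ) ξ :=
    ⟨hξ.continuousOn, hξ.differentiableOn, fun s hs p hp =>
      (hξ.bound s hs p hp).trans (by linarith)⟩
  exact (isHolomorphicFamily_flowMap hk.A_nonneg hj hk.γ₀_lt hk.γ₀_nonneg hk.κ_le hk.κ_angle
    hk.radius hk.polyradius hξ').comp hφ hM fun s hs p hp =>
      hk.flowMap_mem hj hp hs (hξ'.bound s hs p hp)

/-- Lipschitz dependence on the perturbation of a function bounded along all perturbed
trajectories. -/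
theorem IsFlowConstants.lipschitz
    (hk : IsFlowConstants A γ₀ γ₁ r₀ r₁ ρ₀ ρ₁ κ δ C) (hj : j.re = 0)
    {φ : Phase → ℂ} {M : ℝ}
    (hφ : DifferentiableOn ℂ φ (cosDomain γ₁ r₁ ρ₁)) {p : Phase} (hp : p ∈ cosDomain γ₀ r₀ ρ₀)
    {τ : ℝ} (hτ : 0 ≤ τ) (hM : ∀ ξ : Phase, ‖ξ‖ ≤ 2 * κ → ‖φ (flowMap j A τ p ξ)‖ ≤ M)
    {ξ ζ : Phase} (hξ : ‖ξ‖ ≤ κ) (hζ : ‖ζ‖ ≤ κ) {d : ℝ} (hd : ‖ξ - ζ‖ ≤ d) :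
    ‖φ (flowMap j A τ p ξ) - φ (flowMap j A τ p ζ)‖ ≤ 2 * M / κ * d := by
  have hκ := hk.κ_pos
  have hM0 : 0 ≤ M := (norm_nonneg _).trans (hM 0 (by simpa using hκ.le))
  -- Perturbations of size 2κ are admitted so that Cauchy's estimate gives the Lipschitz constant
  -- 2M/κ on the ball of radius κ.
  have hdiff : DifferentiableOn ℂ (fun ξ => φ (flowMap j A τ p ξ)) (ball 0 (2 * κ)) := by
    refine hφ.comp (fun ξ hξ => ?_) fun ξ hξ => hk.flowMap_mem hj hp hτ
      (mem_ball_zero_iff.1 hξ).le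
    have h1 : ‖ξ.1‖ ≤ 1 / 2 :=
      (norm_fst_le ξ).trans ((mem_ball_zero_iff.1 hξ).le.trans hk.κ_le)
    exact (DifferentiableAt.comp (f := fun ξ : Phase => (p, ξ)) ξ
      (differentiableAt_flowMap (one_add_mul_mem_slitPlane hk.γ₀_lt hp.1 hτ)
        (one_add_mem_slitPlane h1)) (by fun_prop)).differentiableWithinAt
  refine (norm_sub_le_of_bounded hκ hdiff (fun z hz => hM z (mem_ball_zero_iff.1 hz).le)
    (mem_closedBall_zero_iff.2 hξ) (mem_closedBall_zero_iff.2 hζ)).trans ?_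
  gcongr

theorem IsFlowConstants.norm_le_weight
    (hk : IsFlowConstants A γ₀ γ₁ r₀ r₁ ρ₀ ρ₁ κ δ C) (hj : j.re = 0)
    {φ : Phase → ℂ}
    (hφ : ∀ p ∈ cosDomain γ₁ r₁ ρ₁, ‖φ p‖ ≤ C * ‖p.1‖ ^ 2) {p : Phase}
    (hp : p ∈ cosDomain γ₀ r₀ ρ₀) {τ : ℝ} (hτ : 0 ≤ τ) {ξ : Phase} (hξ : ‖ξ‖ ≤ 2 * κ) :
    ‖φ (flowMap j A τ p ξ)‖ ≤ C * (4 / (1 - γ₀)) ^ 2 * (‖p.1‖ / (1 + τ * ‖p.1‖)) ^ 2 := by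
  refine (hφ _ (hk.flowMap_mem hj hp hτ hξ)).trans ?_
  have h1 := norm_flow_fst_le hk.γ₀_lt hk.γ₀_nonneg hp.1 hτ
    ((norm_fst_le ξ).trans (hξ.trans hk.κ_le))
  have hC := hk.C_nonneg
  rw [mul_assoc, ← mul_pow]
  gcongr
  exact h1

theorem picardOperator_family
    (hk : IsFlowConstants A γ₀ γ₁ r₀ r₁ ρ₀ ρ₁ κ δ C) (hj : j.re = 0)
    (hX : IsRadialData γ₁ r₁ ρ₁ δ C G B₁ B₂) {ξ : ℝ → Phase → Phase}
    (hξ : IsHolomorphicFamily (cosDomain γ₀ r₀ ρ₀) κ ξ) :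
    IsHolomorphicFamily (cosDomain γ₀ r₀ ρ₀) κ (picardOperator j A G B₁ B₂ ξ) := by
  have hκ := hk.κ_pos
  have hC := hk.C_nonneg
  have hC1 : ∀ φ : Phase → ℂ, (∀ p ∈ cosDomain γ₁ r₁ ρ₁, ‖φ p‖ ≤ C * ‖p.1‖ ^ 2) →
      ∀ p ∈ cosDomain γ₁ r₁ ρ₁, ‖φ p‖ ≤ C * r₁ ^ 2 := fun φ hφ p hp => by
    refine (hφ p hp).trans ?_
    have := hp.1.2.1.le
    gcongr
  have hfG := (hk.family hj hξ (hX.diffG.sub_const 1) hX.boundG).primitive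
    (isOpen_cosDomain _ _ _)
  have hf1 := (hk.family hj hξ hX.diffB₁ (hC1 _ hX.boundB₁)).primitive (isOpen_cosDomain _ _ _)
  have hf2 := (hk.family hj hξ hX.diffB₂ (hC1 _ hX.boundB₂)).primitive (isOpen_cosDomain _ _ _)
  have hne : ∀ τ : ℝ, 0 ≤ τ → ∀ p ∈ cosDomain γ₀ r₀ ρ₀, 1 + (τ : ℂ) * p.1 ≠ 0 :=
    fun τ hτ p hp => Complex.slitPlane_ne_zero (one_add_mul_mem_slitPlane hk.γ₀_lt hp.1 hτ)
  have hB : ∀ φ : Phase → ℂ, (∀ p ∈ cosDomain γ₁ r₁ ρ₁, ‖φ p‖ ≤ C * ‖p.1‖ ^ 2) →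
      ∀ τ ≥ 0, ∀ p ∈ cosDomain γ₀ r₀ ρ₀,
        ‖∫ s in (0 : ℝ)..τ, φ (flowMap j A s p (ξ s p))‖ ≤ κ := by
    intro φ hφ τ hτ p hp
    rw [intervalIntegral.integral_of_le hτ]
    refine (norm_setIntegral_le_of_weight (M := C * (4 / (1 - γ₀)) ^ 2) hp.1.1 (by positivity)
      measurableSet_Ioc (fun s hs => hs.1) fun s hs => ?_).trans ?_
    · exact hk.norm_le_weight hj hφ hp hs.1.le
        ((hξ.bound s hs.1.le p hp).trans (by linarith))
    · have := mul_le_mul_of_nonneg_left hp.1.2.1.le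
        (by positivity : 0 ≤ C * (4 / (1 - γ₀)) ^ 2)
      linarith [hk.C_le]
  refine ⟨?_, fun τ hτ => ?_, fun τ hτ p hp => ?_⟩
  · refine ContinuousOn.prodMk (ContinuousOn.mul (ContinuousOn.div (by fun_prop) (by fun_prop)
      fun q hq => hne q.1 hq.1 q.2 hq.2) hfG.1) (hf1.1.prodMk hf2.1)
  · have hinv : DifferentiableOn ℂ (fun p : Phase => p.1 / (1 + τ * p.1))
        (cosDomain γ₀ r₀ ρ₀) := by
      simp only [div_eq_mul_inv]
      exact DifferentiableOn.fun_mul (by fun_prop)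
        (DifferentiableOn.fun_inv (by fun_prop) fun p hp => hne τ hτ p hp)
    exact (hinv.mul (hfG.2 τ hτ)).prodMk ((hf1.2 τ hτ).prodMk (hf2.2 τ hτ))
  · refine norm_prod_le_iff.2 ⟨?_, norm_prod_le_iff.2 ⟨hB _ hX.boundB₁ τ hτ p hp,
      hB _ hX.boundB₂ τ hτ p hp⟩⟩
    refine (norm_div_mul_integral_le hk.γ₀_lt hk.γ₀_nonneg hp.1 hτ (fun s hs => ?_)
      hk.δ_nonneg).trans (hk.δ_le.trans (by linarith))
    exact hX.boundG _ (hk.flowMap_mem hj hp hs.1.le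
      ((hξ.bound s hs.1.le p hp).trans (by linarith)))

/-- Each component is an integral bounded by κ/4 for perturbations of size up to 2κ; the Cauchy
factor 2/κ turns this bound into the contraction factor 1/2. -/
theorem picardOperator_contraction
    (hk : IsFlowConstants A γ₀ γ₁ r₀ r₁ ρ₀ ρ₁ κ δ C) (hj : j.re = 0)
    (hX : IsRadialData γ₁ r₁ ρ₁ δ C G B₁ B₂)
    {ξ ζ : ℝ → Phase → Phase} (hξ : IsHolomorphicFamily (cosDomain γ₀ r₀ ρ₀) κ ξ)
    (hζ : IsHolomorphicFamily (cosDomain γ₀ r₀ ρ₀) κ ζ) {d : ℝ}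
    (hd : ∀ τ ≥ 0, ∀ p ∈ cosDomain γ₀ r₀ ρ₀, ‖ξ τ p - ζ τ p‖ ≤ d) {τ : ℝ} (hτ : 0 ≤ τ)
    {p : Phase} (hp : p ∈ cosDomain γ₀ r₀ ρ₀) :
    ‖picardOperator j A G B₁ B₂ ξ τ p - picardOperator j A G B₁ B₂ ζ τ p‖ ≤ d / 2 := by
  have hκ := hk.κ_pos
  have hC := hk.C_nonneg
  have hδ := hk.δ_nonneg
  have hd0 : 0 ≤ d := (norm_nonneg _).trans (hd τ hτ p hp)
  have hγ : 0 < 1 - γ₀ := by linarith [hk.γ₀_lt]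
  have hint : ∀ φ : Phase → ℂ, DifferentiableOn ℂ φ (cosDomain γ₁ r₁ ρ₁) →
      ∀ ξ, IsHolomorphicFamily (cosDomain γ₀ r₀ ρ₀) κ ξ →
      IntervalIntegrable (fun s => φ (flowMap j A s p (ξ s p))) volume 0 τ := by
    intro φ hφ ξ hξ
    refine ContinuousOn.intervalIntegrable ?_
    have h1 := isHolomorphicFamily_flowMap (κ := 2 * κ) hk.A_nonneg hj hk.γ₀_lt hk.γ₀_nonneg
      hk.κ_le hk.κ_angle hk.radius hk.polyradius ⟨hξ.continuousOn, hξ.differentiableOn,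
        fun s hs p hp => (hξ.bound s hs p hp).trans (by linarith)⟩
    have h0 : ∀ s ∈ uIcc 0 τ, 0 ≤ s := fun s hs => by rw [uIcc_of_le hτ] at hs; exact hs.1
    refine hφ.continuousOn.comp (h1.continuousOn.comp (f := fun s : ℝ => (s, p)) (by fun_prop)
      fun s hs => ⟨h0 s hs, hp⟩) fun s hs => ?_
    exact hk.flowMap_mem hj hp (h0 s hs) ((hξ.bound s (h0 s hs) p hp).trans (by linarith))
  have hB : ∀ φ : Phase → ℂ, DifferentiableOn ℂ φ (cosDomain γ₁ r₁ ρ₁) →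
      (∀ p ∈ cosDomain γ₁ r₁ ρ₁, ‖φ p‖ ≤ C * ‖p.1‖ ^ 2) →
        ‖(∫ s in (0 : ℝ)..τ, φ (flowMap j A s p (ξ s p))) -
          ∫ s in (0 : ℝ)..τ, φ (flowMap j A s p (ζ s p))‖ ≤ d / 2 := by
    intro φ hφ hφb
    rw [← intervalIntegral.integral_sub (hint φ hφ ξ hξ) (hint φ hφ ζ hζ),
      intervalIntegral.integral_of_le hτ]
    refine (norm_setIntegral_le_of_weight (M := 2 * (C * (4 / (1 - γ₀)) ^ 2) / κ * d) hp.1.1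
      (by positivity) measurableSet_Ioc (fun s hs => hs.1) fun s hs => ?_).trans ?_
    · refine (hk.lipschitz hj hφ hp hs.1.le
        (fun ξ hξ => hk.norm_le_weight hj hφb hp hs.1.le hξ) (hξ.bound s hs.1.le p hp)
        (hζ.bound s hs.1.le p hp) (hd s hs.1.le p hp)).trans (le_of_eq ?_)
      ring
    · have h1 : C * (4 / (1 - γ₀)) ^ 2 * ‖p.1‖ ≤ κ / 4 := by
        have := mul_le_mul_of_nonneg_left hp.1.2.1.le
          (by positivity : 0 ≤ C * (4 / (1 - γ₀)) ^ 2)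
        linarith [hk.C_le]
      calc 2 * (C * (4 / (1 - γ₀)) ^ 2) / κ * d * ‖p.1‖
          = C * (4 / (1 - γ₀)) ^ 2 * ‖p.1‖ * (2 * d / κ) := by ring
        _ ≤ κ / 4 * (2 * d / κ) := by gcongr
        _ = d / 2 := by field_simp; norm_num
  refine norm_prod_le_iff.2 ⟨?_, norm_prod_le_iff.2 ⟨hB _ hX.diffB₁ hX.boundB₁,
    hB _ hX.diffB₂ hX.boundB₂⟩⟩
  have hdG := hX.diffG.sub_const 1
  change ‖p.1 / (1 + τ * p.1) * (∫ s in (0 : ℝ)..τ, (G (flowMap j A s p (ξ s p)) - 1)) -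
    p.1 / (1 + τ * p.1) * ∫ s in (0 : ℝ)..τ, (G (flowMap j A s p (ζ s p)) - 1)‖ ≤ d / 2
  rw [← mul_sub, ← intervalIntegral.integral_sub (hint _ hdG ξ hξ) (hint _ hdG ζ hζ)]
  refine (norm_div_mul_integral_le (δ := 2 * δ / κ * d) hk.γ₀_lt hk.γ₀_nonneg hp.1 hτ
    (fun s hs => ?_) (by positivity)).trans ?_
  · exact hk.lipschitz hj hdG hp hs.1.le
      (fun ξ hξ => hX.boundG _ (hk.flowMap_mem hj hp hs.1.le hξ)) (hξ.bound s hs.1.le p hp)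
      (hζ.bound s hs.1.le p hp) (hd s hs.1.le p hp)
  · calc 2 / (1 - γ₀) * (2 * δ / κ * d) = 2 / (1 - γ₀) * δ * (2 * d / κ) := by ring
      _ ≤ κ / 4 * (2 * d / κ) := by
          have := hk.δ_le
          gcongr
      _ = d / 2 := by field_simp; norm_num

end FlowExistence

/-! ### The semiflow and integration along it -/

section Semiflow

/-- A holomorphic semiflow of `X`, defined on `Ω` with values in `U`, attracted by `{h = 0}` and
with bounded growth in `𝐲`. -/
structure IsAttractedSemiflow (Ω U : Set Phase) (X : Phase → Phase) (K : ℝ)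
    (Φ : ℝ → Phase → Phase) : Prop where
  continuousOn : ContinuousOn (fun q : ℝ × Phase => Φ q.1 q.2) (Ici 0 ×ˢ Ω)
  differentiableOn : ∀ τ ≥ 0, DifferentiableOn ℂ (Φ τ) Ω
  mapsTo : ∀ τ ≥ 0, ∀ p ∈ Ω, Φ τ p ∈ U
  map_zero : ∀ p ∈ Ω, Φ 0 p = p
  deriv : ∀ τ ≥ 0, ∀ p ∈ Ω, HasDerivWithinAt (fun t => Φ t p) (X (Φ τ p)) (Ici τ) τ
  norm_fst_le : ∀ τ ≥ 0, ∀ p ∈ Ω, ‖(Φ τ p).1‖ ≤ K * (‖p.1‖ / (1 + τ * ‖p.1‖))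
  norm_snd_le : ∀ τ ≥ 0, ∀ p ∈ Ω, ‖(Φ τ p).2‖ ≤ K * ‖p.2‖

theorem hasDerivWithinAt_primitive {f : ℝ → ℂ} (hf : ContinuousOn f (Ici 0)) {τ : ℝ}
    (hτ : 0 ≤ τ) : HasDerivWithinAt (fun t => ∫ s in (0 : ℝ)..t, f s) (f τ) (Ici τ) τ := by
  have hsub : Ioi τ ⊆ Ici 0 := fun s hs => hτ.trans (le_of_lt hs)
  refine intervalIntegral.integral_hasDerivWithinAt_right (t := Ioi τ) ?_ ?_ ?_
  · refine (hf.mono fun s hs => ?_).intervalIntegrable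
    rw [uIcc_of_le hτ] at hs
    exact hs.1
  · exact (hf.mono hsub).stronglyMeasurableAtFilter_nhdsWithin measurableSet_Ioi τ
  · exact (hf τ hτ).mono hsub

/-- The flow equation satisfied by `flowMap` along a fixed point of the Picard operator. -/
theorem hasDerivWithinAt_flowMap {j A : ℂ} {τ : ℝ} {p : Phase} {ξ : ℝ → Phase}
    {J : ℝ → ℂ} {G B₁ B₂ : ℂ} (hs : 1 + τ * p.1 ∈ Complex.slitPlane)
    (hs' : 1 + (ξ τ).1 ∈ Complex.slitPlane) (hξ : ∀ t ≥ τ, (ξ t).1 = p.1 / (1 + t * p.1) * J t)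
    (hne : ∀ t ≥ τ, 1 + (t : ℂ) * p.1 ≠ 0)
    (hJ : HasDerivWithinAt J (G - 1) (Ici τ) τ)
    (h1 : HasDerivWithinAt (fun t => (ξ t).2.1) B₁ (Ici τ) τ)
    (h2 : HasDerivWithinAt (fun t => (ξ t).2.2) B₂ (Ici τ) τ) :
    HasDerivWithinAt (fun t => flowMap j A t p (ξ t))
      (-(flowMap j A τ p (ξ τ)).1 ^ 2 * G,
        (flowMap j A τ p (ξ τ)).2.1 * (-j - A * (flowMap j A τ p (ξ τ)).1 * G + B₁),
        (flowMap j A τ p (ξ τ)).2.2 * (j - A * (flowMap j A τ p (ξ τ)).1 * G + B₂))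
      (Ici τ) τ := by
  have hne0 : 1 + (τ : ℂ) * p.1 ≠ 0 := hne τ le_rfl
  have hne1 : 1 + (ξ τ).1 ≠ 0 := Complex.slitPlane_ne_zero hs'
  have hid : HasDerivWithinAt (fun t : ℝ => (t : ℂ)) 1 (Ici τ) τ :=
    (hasDerivAt_id τ).ofReal_comp.hasDerivWithinAt
  have hlin : HasDerivWithinAt (fun t : ℝ => 1 + (t : ℂ) * p.1) p.1 (Ici τ) τ := by
    simpa using (hid.mul_const p.1).const_add 1
  have hω : HasDerivWithinAt (fun t => (ξ t).1)
      (-p.1 * p.1 / (1 + τ * p.1) ^ 2 * J τ + p.1 / (1 + τ * p.1) * (G - 1)) (Ici τ) τ := by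
    refine HasDerivWithinAt.congr (f := fun t => p.1 / (1 + t * p.1) * J t) ?_
      (fun t ht => hξ t ht) (hξ τ le_rfl)
    refine (((hasDerivWithinAt_const τ (Ici τ) p.1).fun_div hlin hne0).fun_mul hJ).congr_deriv ?_
    simp
  -- Formally (1 + τh)(1 + ω) = 1 + h∫G, whose logarithmic derivative is hG/((1 + τh)(1 + ω)), the
  -- current first coordinate times G. The identity `e1` removes J in favour of ω.
  have hlog : HasDerivWithinAt (fun t => flowExponent A t p.1 (ξ t).1)
      (A * (flowMap j A τ p (ξ τ)).1 * G) (Ici τ) τ := by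
    unfold flowExponent
    refine (((hlin.clog_real hs).fun_add ((hω.const_add 1).clog_real hs')).const_mul
      A).congr_deriv ?_
    simp only [flowMap]
    rw [mul_assoc]
    congr 1
    have e1 : -p.1 * p.1 / (1 + τ * p.1) ^ 2 * J τ = -p.1 * (ξ τ).1 / (1 + τ * p.1) := by
      rw [hξ τ le_rfl]; field_simp
    rw [e1]
    field_simp
    ring
  have hfst : HasDerivWithinAt (fun t => (flowMap j A t p (ξ t)).1)
      (-(flowMap j A τ p (ξ τ)).1 ^ 2 * G) (Ici τ) τ := by
    have hprod := hlin.fun_mul (hω.const_add 1)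
    refine ((hasDerivWithinAt_const τ (Ici τ) p.1).fun_div hprod
      (mul_ne_zero hne0 hne1)).congr_deriv ?_
    simp only [flowMap]
    have e1 : -p.1 * p.1 / (1 + τ * p.1) ^ 2 * J τ = -p.1 * (ξ τ).1 / (1 + τ * p.1) := by
      rw [hξ τ le_rfl]; field_simp
    rw [e1]
    field_simp
    ring
  refine hfst.prodMk (HasDerivWithinAt.prodMk ?_ ?_)
  · refine ((((hid.const_mul (-j)).fun_sub hlog).fun_add h1).cexp.const_mul p.2.1).congr_deriv ?_
    simp only [flowMap]
    ring
  · refine ((((hid.const_mul j).fun_sub hlog).fun_add h2).cexp.const_mul p.2.2).congr_deriv ?_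
    simp only [flowMap]
    ring

/-- The semiflow is `flowMap` evaluated at the fixed point of the Picard operator: differentiating
the integral equations gives the differential equation, and the growth bounds are those of the
explicit flow with bounded perturbation. -/
theorem exists_attractedSemiflow {j A : ℂ} {γ₀ γ₁ r₀ r₁ ρ₀ ρ₁ κ δ C : ℝ} {G B₁ B₂ : Phase → ℂ}
    (hk : IsFlowConstants A γ₀ γ₁ r₀ r₁ ρ₀ ρ₁ κ δ C) (hj : j.re = 0)
    (hX : IsRadialData γ₁ r₁ ρ₁ δ C G B₁ B₂) :
    ∃ Φ, IsAttractedSemiflow (cosDomain γ₀ r₀ ρ₀) (cosDomain γ₁ r₁ ρ₁)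
      (radialField j A G B₁ B₂) (max (4 / (1 - γ₀)) (growthBound γ₀ A)) Φ := by
  have hκ := hk.κ_pos
  obtain ⟨ξ, hξ, hfix⟩ := exists_fixedPoint_of_contraction (isOpen_cosDomain γ₀ r₀ ρ₀) hκ.le
    (picardOperator j A G B₁ B₂) (fun ξ hξ => picardOperator_family hk hj hX hξ)
    (fun ξ ζ hξ hζ d hd τ hτ p hp => picardOperator_contraction hk hj hX hξ hζ hd hτ hp)
  have hb : ∀ τ ≥ 0, ∀ p ∈ cosDomain γ₀ r₀ ρ₀, ‖ξ τ p‖ ≤ 2 * κ := fun τ hτ p hp =>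
    (hξ.bound τ hτ p hp).trans (by linarith)
  have hhalf : ∀ τ ≥ 0, ∀ p ∈ cosDomain γ₀ r₀ ρ₀, ‖ξ τ p‖ ≤ 1 / 2 := fun τ hτ p hp =>
    (hb τ hτ p hp).trans hk.κ_le
  have hfam := isHolomorphicFamily_flowMap (j := j) (κ := 2 * κ) hk.A_nonneg hj hk.γ₀_lt
    hk.γ₀_nonneg hk.κ_le hk.κ_angle hk.radius hk.polyradius
    ⟨hξ.continuousOn, hξ.differentiableOn, hb⟩
  have hmaps : ∀ τ ≥ 0, ∀ p ∈ cosDomain γ₀ r₀ ρ₀,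
      flowMap j A τ p (ξ τ p) ∈ cosDomain γ₁ r₁ ρ₁ := fun τ hτ p hp =>
    hk.flowMap_mem hj hp hτ (hb τ hτ p hp)
  refine ⟨fun τ p => flowMap j A τ p (ξ τ p), hfam.continuousOn, hfam.differentiableOn, hmaps,
    fun p hp => ?_, fun τ hτ p hp => ?_, fun τ hτ p hp => ?_, fun τ hτ p hp => ?_⟩
  · have h0 : ξ 0 p = 0 := by
      rw [← hfix 0 le_rfl p hp]
      simp [picardOperator]
    simp [h0, flowMap, flowExponent]
  · have hsl : ∀ t : ℝ, 0 ≤ t → 1 + (t : ℂ) * p.1 ∈ Complex.slitPlane := fun t ht =>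
      one_add_mul_mem_slitPlane hk.γ₀_lt hp.1 ht
    have hcont : ∀ φ : Phase → ℂ, DifferentiableOn ℂ φ (cosDomain γ₁ r₁ ρ₁) →
        ContinuousOn (fun s => φ (flowMap j A s p (ξ s p))) (Ici 0) := fun φ hφ =>
      hφ.continuousOn.comp (hfam.continuousOn.comp (f := fun s : ℝ => (s, p)) (by fun_prop)
        fun s hs => ⟨hs, hp⟩) fun s hs => hmaps s hs p hp
    have hfix' : ∀ t ≥ τ, ξ t p = picardOperator j A G B₁ B₂ ξ t p := fun t ht =>
      (hfix t (hτ.trans ht) p hp).symm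
    refine hasDerivWithinAt_flowMap (ξ := fun t => ξ t p)
      (J := fun t => ∫ s in (0 : ℝ)..t, (G (flowMap j A s p (ξ s p)) - 1)) (hsl τ hτ)
      (one_add_mem_slitPlane ((norm_fst_le _).trans (hhalf τ hτ p hp)))
      (fun t ht => by rw [hfix' t ht]; rfl)
      (fun t ht => Complex.slitPlane_ne_zero (hsl t (hτ.trans ht)))
      (hasDerivWithinAt_primitive (hcont _ (hX.diffG.sub_const 1)) hτ) ?_ ?_
    · exact (hasDerivWithinAt_primitive (hcont _ hX.diffB₁) hτ).congr
        (fun t ht => by rw [hfix' t ht]; rfl) (by rw [hfix' τ le_rfl]; rfl)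
    · exact (hasDerivWithinAt_primitive (hcont _ hX.diffB₂) hτ).congr
        (fun t ht => by rw [hfix' t ht]; rfl) (by rw [hfix' τ le_rfl]; rfl)
  · refine (norm_flow_fst_le hk.γ₀_lt hk.γ₀_nonneg hp.1 hτ
      ((norm_fst_le _).trans (hhalf τ hτ p hp))).trans ?_
    gcongr
    exact le_max_left _ _
  · refine (norm_flowMap_snd_le hk.A_nonneg hj hk.γ₀_lt hk.γ₀_nonneg hp.1 hτ
      (hhalf τ hτ p hp)).trans ?_
    gcongr
    exact le_max_right _ _

variable {Ω U : Set Phase} {X : Phase → Phase} {K : ℝ} {Φ : ℝ → Phase → Phase}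

theorem IsAttractedSemiflow.continuousOn_curve (h : IsAttractedSemiflow Ω U X K Φ) {p : Phase}
    (hp : p ∈ Ω) : ContinuousOn (fun t => Φ t p) (Ici 0) :=
  h.continuousOn.comp (f := fun t : ℝ => (t, p)) (by fun_prop) fun _ ht => ⟨ht, hp⟩

/-- Uniqueness for the differential equation: on a finite time interval both trajectories stay in a
compact subset of U, on which the holomorphic field X is Lipschitz. -/
theorem IsAttractedSemiflow.map_add (h : IsAttractedSemiflow Ω U X K Φ) (hU : IsOpen U)
    (hX : DifferentiableOn ℂ X U) {p : Phase} (hp : p ∈ Ω) {τ : ℝ} (hτ : 0 ≤ τ)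
    (hq : Φ τ p ∈ Ω) {s : ℝ} (hs : 0 ≤ s) : Φ s (Φ τ p) = Φ (τ + s) p := by
  have hc1 : ContinuousOn (fun t => Φ t (Φ τ p)) (Icc 0 s) :=
    (h.continuousOn_curve hq).mono fun t ht => ht.1
  have hc2 : ContinuousOn (fun t => Φ (τ + t) p) (Icc 0 s) :=
    (h.continuousOn_curve hp).comp (f := fun t => τ + t) (by fun_prop) fun t ht =>
      add_nonneg hτ ht.1
  set S := (fun t => Φ t (Φ τ p)) '' Icc 0 s ∪ (fun t => Φ (τ + t) p) '' Icc 0 s with hS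
  have hSc : IsCompact S := (isCompact_Icc.image_of_continuousOn hc1).union
    (isCompact_Icc.image_of_continuousOn hc2)
  have hSU : S ⊆ U := by
    rintro _ (⟨t, ht, rfl⟩ | ⟨t, ht, rfl⟩)
    · exact h.mapsTo t ht.1 _ hq
    · exact h.mapsTo _ (add_nonneg hτ ht.1) _ hp
  obtain ⟨L, hL⟩ := LocallyLipschitzOn.exists_lipschitzOnWith_of_compact hSc
    ((locallyLipschitzOn_of_differentiableOn hU hX).mono hSU)
  refine ODE_solution_unique_of_mem_Icc_right (v := fun _ => X) (s := fun _ => S) (K := L)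
    (a := 0) (b := s) (fun _ _ => hL) hc1 (fun t ht => h.deriv t ht.1 _ hq)
    (fun t ht => Or.inl ⟨t, Ico_subset_Icc_self ht, rfl⟩) hc2 (fun t ht => ?_)
    (fun t ht => Or.inr ⟨t, Ico_subset_Icc_self ht, rfl⟩) ?_ (right_mem_Icc.2 hs)
  · have h1 := h.deriv (τ + t) (add_nonneg hτ ht.1) p hp
    have h2 : HasDerivWithinAt (fun t => τ + t) 1 (Ici t) t :=
      ((hasDerivAt_id t).const_add τ).hasDerivWithinAt
    have h3 := HasDerivWithinAt.scomp (t' := Ici (τ + t)) t h1 h2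
      fun u hu => add_le_add_right (mem_Ici.1 hu) τ
    rw [one_smul] at h3
    exact h3
  · simp [h.map_zero _ hq]

/-- Solution of the homological equation `X χ = f` by integration along the semiflow. -/
theorem IsAttractedSemiflow.exists_homological {γ₀ r₀ ρ₀ : ℝ}
    (h : IsAttractedSemiflow (cosDomain γ₀ r₀ ρ₀) U X K Φ) (hU : IsOpen U)
    (hX : DifferentiableOn ℂ X U) {f : Phase → ℂ} (hf : DifferentiableOn ℂ f U) {C : ℝ}
    (hC : 0 ≤ C) (hK : 0 ≤ K) {m : ℕ} (hr₀ : 0 < r₀)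
    (hfb : ∀ p ∈ U, ‖f p‖ ≤ C * ‖p.1‖ ^ (m + 2) * ‖p.2‖) :
    ∃ χ : Phase → ℂ, DifferentiableOn ℂ χ (cosDomain γ₀ r₀ ρ₀) ∧
      (∀ p ∈ cosDomain γ₀ r₀ ρ₀, fderiv ℂ χ p (X p) = f p) ∧
      ∀ p ∈ cosDomain γ₀ r₀ ρ₀, ‖χ p‖ ≤ C * K ^ (m + 3) * ‖p.1‖ ^ (m + 1) * ‖p.2‖ := by
  set Ω := cosDomain γ₀ r₀ ρ₀ with hΩ
  -- Two of the m + 2 powers of h supply the integrable weight; the other m are bounded by their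
  -- initial value.
  have hbound : ∀ p ∈ Ω, ∀ s ≥ 0, ‖f (Φ s p)‖ ≤
      C * K ^ (m + 3) * ‖p.1‖ ^ m * ‖p.2‖ * (‖p.1‖ / (1 + s * ‖p.1‖)) ^ 2 := by
    intro p hp s hs
    refine (hfb _ (h.mapsTo s hs p hp)).trans ?_
    have h1 := h.norm_fst_le s hs p hp
    have h2 := h.norm_snd_le s hs p hp
    have h3 : ‖p.1‖ / (1 + s * ‖p.1‖) ≤ ‖p.1‖ := by
      refine div_le_self (norm_nonneg _) ?_
      have : 0 ≤ s * ‖p.1‖ := by positivity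
      linarith
    calc C * ‖(Φ s p).1‖ ^ (m + 2) * ‖(Φ s p).2‖
        ≤ C * (K * (‖p.1‖ / (1 + s * ‖p.1‖))) ^ (m + 2) * (K * ‖p.2‖) := by gcongr
      _ = C * K ^ (m + 3) * (‖p.1‖ / (1 + s * ‖p.1‖)) ^ m * ‖p.2‖ *
          (‖p.1‖ / (1 + s * ‖p.1‖)) ^ 2 := by
          rw [mul_pow, pow_add (‖p.1‖ / (1 + s * ‖p.1‖)), pow_add K, pow_add K]
          ring
      _ ≤ _ := by gcongr
  have hcont : ∀ p ∈ Ω, ContinuousOn (fun s => f (Φ s p)) (Ici 0) := fun p hp =>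
    hf.continuousOn.comp (h.continuousOn_curve hp) fun s hs => h.mapsTo s hs p hp
  have hint : ∀ p ∈ Ω, IntegrableOn (fun s => f (Φ s p)) (Ioi 0) := by
    intro p hp
    refine Integrable.mono' ((integral_weight hp.1.1).1.const_mul
      (C * K ^ (m + 3) * ‖p.1‖ ^ m * ‖p.2‖))
      (((hcont p hp).mono Ioi_subset_Ici_self).aestronglyMeasurable measurableSet_Ioi) ?_
    filter_upwards [ae_restrict_mem measurableSet_Ioi] with s hs using hbound p hp s (le_of_lt hs)
  have hdiff : DifferentiableOn ℂ (fun p => -∫ s in Ioi (0 : ℝ), f (Φ s p)) Ω := by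
    refine (differentiableOn_integral (isOpen_cosDomain _ _ _) (fun p hp => (hint p hp).1)
      (bound := fun s => C * K ^ (m + 3) * r₀ ^ m * ρ₀ * (r₀ / (1 + s * r₀)) ^ 2) ?_ ?_
      ((integral_weight hr₀).1.const_mul _)).neg
    · filter_upwards [ae_restrict_mem measurableSet_Ioi] with s hs
      exact hf.comp (h.differentiableOn s (le_of_lt hs)) fun p hp => h.mapsTo s (le_of_lt hs) p hp
    · filter_upwards [ae_restrict_mem measurableSet_Ioi] with s hs p hp
      have hs' : 0 ≤ s := le_of_lt hs
      refine (hbound p hp s hs').trans ?_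
      have h1 := hp.1.2.1.le
      have h2 := hp.2.le
      have h3 : ‖p.1‖ / (1 + s * ‖p.1‖) ≤ r₀ / (1 + s * r₀) := by
        rw [div_le_div_iff₀ (by positivity) (by positivity)]
        nlinarith
      have hρ : 0 ≤ ρ₀ := (norm_nonneg _).trans h2
      gcongr
  refine ⟨fun p => -∫ s in Ioi (0 : ℝ), f (Φ s p), hdiff, fun p hp => ?_, fun p hp => ?_⟩
  · have hcurve := h.deriv 0 le_rfl p hp
    have hev : ∀ᶠ t in 𝓝[Ici 0] (0 : ℝ), Φ t p ∈ Ω := by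
      have h1 := hcurve.continuousWithinAt.tendsto
      simp only [h.map_zero p hp] at h1
      exact h1 ((isOpen_cosDomain _ _ _).mem_nhds hp)
    -- By the semigroup law, moving p to Φ t p removes the times before t from the integral.
    -- Comparing its right derivative at t = 0 with the chain rule gives Xχ = f; only small t
    -- matter, for which Φ t p stays in the open set Ω.
    have hkey : ∀ t ≥ 0, Φ t p ∈ Ω → -∫ s in Ioi (0 : ℝ), f (Φ s (Φ t p)) =
        (∫ s in (0 : ℝ)..t, f (Φ s p)) - ∫ s in Ioi (0 : ℝ), f (Φ s p) := by
      intro t ht htΩ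
      have h1 : ∫ s in Ioi (0 : ℝ), f (Φ s (Φ t p)) = ∫ s in Ioi t, f (Φ s p) := by
        have h2 : ∫ s in Ioi (0 : ℝ), f (Φ s (Φ t p)) = ∫ s in Ioi (0 : ℝ), f (Φ (s + t) p) :=
          setIntegral_congr_fun measurableSet_Ioi fun s hs => by
            simp only [h.map_add hU hX hp ht htΩ (le_of_lt (mem_Ioi.1 hs)), add_comm t s]
        have h3 := (measurePreserving_add_right volume t).setIntegral_preimage_emb
          (measurableEmbedding_addRight t) (fun s => f (Φ s p)) (Ioi t)
        rw [preimage_add_const_Ioi, sub_self] at h3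
        rw [h2, h3]
      rw [h1, ← intervalIntegral.integral_Ioi_sub_Ioi (hint p hp) ht]
      ring
    have hd1 : HasDerivWithinAt (fun t => -∫ s in Ioi (0 : ℝ), f (Φ s (Φ t p))) (f p) (Ici 0)
        0 := by
      have h1 := (hasDerivWithinAt_primitive (hcont p hp) le_rfl).sub_const
        (∫ s in Ioi (0 : ℝ), f (Φ s p))
      simp only [h.map_zero p hp] at h1
      refine h1.congr_of_eventuallyEq ?_ ?_
      · filter_upwards [hev, self_mem_nhdsWithin] with t ht ht0 using hkey t ht0 ht
      · exact hkey 0 le_rfl (by rwa [h.map_zero p hp])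
    have hd2 : HasDerivWithinAt (fun t => -∫ s in Ioi (0 : ℝ), f (Φ s (Φ t p)))
        (fderiv ℂ (fun p => -∫ s in Ioi (0 : ℝ), f (Φ s p)) p (X p)) (Ici 0) 0 := by
      have h1 := (hdiff.differentiableAt
        ((isOpen_cosDomain _ _ _).mem_nhds hp)).hasFDerivAt.restrictScalars ℝ
      rw [← h.map_zero p hp] at h1
      have h2 := h1.comp_hasDerivWithinAt (0 : ℝ) hcurve
      rw [h.map_zero p hp] at h2
      exact h2
    exact (uniqueDiffOn_Ici (0 : ℝ) 0 self_mem_Ici).eq_deriv _ hd2 hd1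
  · rw [norm_neg]
    refine (norm_setIntegral_le_of_weight hp.1.1 (by positivity) measurableSet_Ioi subset_rfl
      fun s hs => hbound p hp s (le_of_lt hs)).trans (le_of_eq ?_)
    ring

end Semiflow

/-! ### The homological equation for the original field -/

section Homological

theorem IsRadialData.differentiableOn_radialField {j A : ℂ} {γ r ρ δ C : ℝ} {G B₁ B₂ : Phase → ℂ}
    (hX : IsRadialData γ r ρ δ C G B₁ B₂) :
    DifferentiableOn ℂ (radialField j A G B₁ B₂) (cosDomain γ r ρ) := by
  have h1 := hX.diffG
  have h2 := hX.diffB₁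
  have h3 := hX.diffB₂
  unfold radialField
  fun_prop

/-- The order of the constants matters: δ depends only on the angles, so the domain can afterwards
be shrunk until ‖G − 1‖ ≤ δ, while the size C of B₁, B₂ is absorbed by r₀. -/
theorem exists_homological_radial {j A : ℂ} (hj : j.re = 0) (hA : 0 ≤ A.re) {γ₀ γ₁ : ℝ}
    (hγ₀ : 0 ≤ γ₀) (hγ : γ₀ < γ₁) (hγ₁ : γ₁ < 1) :
    ∃ δ > 0, ∀ r₁ > 0, ∀ ρ₁ > 0, ∀ C ≥ 0, ∀ G B₁ B₂ : Phase → ℂ,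
      IsRadialData γ₁ r₁ ρ₁ δ C G B₁ B₂ →
      ∃ r₀ ∈ Ioc 0 r₁, ∃ ρ₀ ∈ Ioc 0 ρ₁, ∃ K ≥ 0, ∀ (f : Phase → ℂ) (m : ℕ), ∀ C' ≥ 0,
        DifferentiableOn ℂ f (cosDomain γ₁ r₁ ρ₁) →
        (∀ p ∈ cosDomain γ₁ r₁ ρ₁, ‖f p‖ ≤ C' * ‖p.1‖ ^ (m + 2) * ‖p.2‖) →
        ∃ χ : Phase → ℂ, DifferentiableOn ℂ χ (cosDomain γ₀ r₀ ρ₀) ∧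
          (∀ p ∈ cosDomain γ₀ r₀ ρ₀, fderiv ℂ χ p (radialField j A G B₁ B₂ p) = f p) ∧
          ∀ p ∈ cosDomain γ₀ r₀ ρ₀, ‖χ p‖ ≤ C' * K ^ (m + 3) * ‖p.1‖ ^ (m + 1) * ‖p.2‖ := by
  -- Since 1 + γ₁ ≤ 2, the loss of angle 2κ(1 + γ₁) is at most (γ₁ − γ₀)/2.
  set κ := (γ₁ - γ₀) / 8 with hκ
  have hκ0 : 0 < κ := by rw [hκ]; linarith
  have h1γ : 0 < 1 - γ₀ := by linarith
  refine ⟨(1 - γ₀) / 2 * (κ / 4), by positivity, ?_⟩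
  intro r₁ hr₁ ρ₁ hρ₁ C hC G B₁ B₂ hX
  have hg := growthBound_pos γ₀ A
  set Q := C * (4 / (1 - γ₀)) ^ 2 with hQ
  have hQ0 : 0 ≤ Q := by positivity
  set r₀ := min r₁ (min (r₁ * ((1 - γ₀) / 4)) (κ / 4 / (Q + 1))) with hr₀
  set ρ₀ := min ρ₁ (ρ₁ / growthBound γ₀ A) with hρ₀
  have hr₀0 : 0 < r₀ := lt_min hr₁ (lt_min (by positivity) (by positivity))
  have hρ₀0 : 0 < ρ₀ := lt_min hρ₁ (by positivity)
  have hk : IsFlowConstants A γ₀ γ₁ r₀ r₁ ρ₀ ρ₁ κ ((1 - γ₀) / 2 * (κ / 4)) C := by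
    refine ⟨hγ₀, by linarith, hA, hκ0, by rw [hκ]; linarith, ?_, ?_, ?_, by positivity, ?_, hC, ?_⟩
    · rw [hκ]; nlinarith
    · calc 4 / (1 - γ₀) * r₀ ≤ 4 / (1 - γ₀) * (r₁ * ((1 - γ₀) / 4)) := by
            gcongr
            exact (min_le_right _ _).trans (min_le_left _ _)
        _ = r₁ := by field_simp
    · calc growthBound γ₀ A * ρ₀ ≤ growthBound γ₀ A * (ρ₁ / growthBound γ₀ A) := by
            gcongr
            exact min_le_right _ _
        _ = ρ₁ := by field_simp
    · apply le_of_eq; field_simp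
    · calc Q * r₀ ≤ (Q + 1) * (κ / 4 / (Q + 1)) := by
            gcongr
            · linarith
            · exact (min_le_right _ _).trans (min_le_right _ _)
        _ = κ / 4 := by field_simp
  obtain ⟨Φ, hΦ⟩ := exists_attractedSemiflow hk hj hX
  refine ⟨r₀, ⟨hr₀0, min_le_left _ _⟩, ρ₀, ⟨hρ₀0, min_le_left _ _⟩, _,
    hg.le.trans (le_max_right (4 / (1 - γ₀)) (growthBound γ₀ A)), ?_⟩
  intro f m C' hC' hf hfb
  exact hΦ.exists_homological (isOpen_cosDomain _ _ _) hX.differentiableOn_radialField hf hC'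
    (hg.le.trans (le_max_right _ _)) hr₀0 hfb

/-- The image of `cosDomain γ r ρ` under `(h, 𝐲) ↦ (ν h, 𝐲)`. -/
def scaledDomain (ν : ℂ) (γ r ρ : ℝ) : Set Phase :=
  {p | ((p.1 / ν, p.2) : Phase) ∈ cosDomain γ r ρ}

theorem isOpen_scaledDomain (ν : ℂ) (γ r ρ : ℝ) : IsOpen (scaledDomain ν γ r ρ) :=
  (isOpen_cosDomain γ r ρ).preimage (by fun_prop)

theorem scaledDomain_mono {ν : ℂ} {γ γ' r r' ρ ρ' : ℝ} (hγ : γ ≤ γ') (hr : r ≤ r')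
    (hρ : ρ ≤ ρ') : scaledDomain ν γ r ρ ⊆ scaledDomain ν γ' r' ρ' :=
  fun _ hp => cosDomain_mono hγ hr hρ hp

theorem norm_fst_lt_of_mem_scaledDomain {ν : ℂ} (hν : ν ≠ 0) {γ r ρ : ℝ} {p : Phase}
    (hp : p ∈ scaledDomain ν γ r ρ) : ‖p.1‖ < ‖ν‖ * r := by
  have h := hp.1.2.1
  simp only [norm_div] at h
  rwa [div_lt_iff₀ (norm_pos_iff.2 hν), mul_comm] at h

theorem norm_mul_snd_le {p : Phase} : ‖p.2.1 * p.2.2‖ ≤ ‖p.2‖ ^ 2 := by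
  rw [norm_mul, sq]
  exact mul_le_mul (norm_fst_le _) (norm_snd_le _) (norm_nonneg _) (norm_nonneg _)

/-- The time change G = l/(l + c(v) + (a₂ − a₁)x/2) normalizes the opposite parts of the two
eigenvalues to −j and j. This removes c(v), which could otherwise produce exponential growth of y,
and leaves the mean (a₁ + a₂)/2 in both equations. -/
theorem radialField_eq_smul {l a₁ a₂ j G h u w : ℂ} (hl : l ≠ 0) (hj : j ^ 2 = -1)
    {M : ℕ} {c : ℂ → ℂ} {D R : Phase → ℂ} {y : ℂ × ℂ}
    (hG : G * (l + c (y.1 * y.2) + (a₂ - a₁) / 2 * (j * l * h)) = l)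
    (hu : u = R (j * l * h, y) - D (j * l * h, y)) (hw : w = R (j * l * h, y) + D (j * l * h, y)) :
    ((-h ^ 2 * G, y.1 * (-j - (a₁ + a₂) / 2 * h * G + j * G / l * (j * l * h) ^ M * u),
      y.2 * (j - (a₁ + a₂) / 2 * h * G + j * G / l * (j * l * h) ^ M * w)) : Phase) =
    (j * G / l) • ((normalizedUpTo M l a₁ a₂ c D R (j * l * h, y)).1 / (j * l),
      (normalizedUpTo M l a₁ a₂ c D R (j * l * h, y)).2) := by
  have hj0 : j ≠ 0 := by rintro rfl; norm_num at hj
  subst hu hw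
  set g := j * G / l with hg
  have hgl : g * l = j * G := by rw [hg]; field_simp
  simp only [normalizedUpTo, fieldY₀, fieldC, fieldR, Prod.smul_mk, Prod.mk_add_mk, smul_eq_mul,
    mul_zero, zero_add, add_zero, Prod.mk.injEq]
  set cv := c (y.1 * y.2)
  set Dv := D (j * l * h, y)
  set Rv := R (j * l * h, y)
  have hgd : g * (l + cv + (a₂ - a₁) / 2 * (j * l * h)) = j := by
    rw [hg, div_mul_eq_mul_div, mul_assoc, hG, mul_div_assoc, div_self hl, mul_one]
  refine ⟨?_, ?_, ?_⟩
  · have : j * l * h * (j * l * h) / (j * l) = j * l * h ^ 2 := by field_simp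
    rw [this]
    linear_combination (-(j * h ^ 2)) * hgl + (-(h ^ 2 * G)) * hj
  · linear_combination (y.1) * hgd + (-(y.1 * (a₁ + a₂) / 2 * j * h)) * hgl +
      (-(y.1 * (a₁ + a₂) / 2 * h * G)) * hj
  · linear_combination (-(y.2)) * hgd + (-(y.2 * (a₁ + a₂) / 2 * j * h)) * hgl +
      (-(y.2 * (a₁ + a₂) / 2 * h * G)) * hj

/-- The homological equation `Y χ = f` for the field normalized up to order `M`. -/
theorem exists_homological {l a₁ a₂ j : ℂ} (hl : l ≠ 0) (hj : j ^ 2 = -1) (hj0 : j.re = 0)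
    (ha : 0 ≤ (a₁ + a₂).re) {γ₀ γ₁ : ℝ} (hγ₀ : 0 ≤ γ₀) (hγ : γ₀ < γ₁) (hγ₁ : γ₁ < 1)
    {c : ℂ → ℂ} {t Lc : ℝ} (ht : 0 < t) (hLc : 0 ≤ Lc) (hcd : DifferentiableOn ℂ c (ball 0 t))
    (hcb : ∀ z ∈ ball (0 : ℂ) t, ‖c z‖ ≤ Lc * ‖z‖) :
    ∃ ε > 0, ∀ r₁ ∈ Ioc 0 ε, ∀ ρ₁ ∈ Ioc 0 ε, ∀ L ≥ 0, ∀ (M : ℕ) (D R : Phase → ℂ), 2 ≤ M →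
      DifferentiableOn ℂ D (scaledDomain (j * l) γ₁ r₁ ρ₁) →
      DifferentiableOn ℂ R (scaledDomain (j * l) γ₁ r₁ ρ₁) →
      (∀ p ∈ scaledDomain (j * l) γ₁ r₁ ρ₁, ‖D p‖ ≤ L * ‖p.2‖) →
      (∀ p ∈ scaledDomain (j * l) γ₁ r₁ ρ₁, ‖R p‖ ≤ L * ‖p.2‖) →
      ∃ r₀ ∈ Ioc 0 r₁, ∃ ρ₀ ∈ Ioc 0 ρ₁, ∀ (f : Phase → ℂ) (m : ℕ), ∀ C ≥ 0,
        DifferentiableOn ℂ f (scaledDomain (j * l) γ₁ r₁ ρ₁) →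
        (∀ p ∈ scaledDomain (j * l) γ₁ r₁ ρ₁, ‖f p‖ ≤ C * ‖p.1‖ ^ (m + 2) * ‖p.2‖) →
        ∃ χ : Phase → ℂ, DifferentiableOn ℂ χ (scaledDomain (j * l) γ₀ r₀ ρ₀) ∧
          (∀ p ∈ scaledDomain (j * l) γ₀ r₀ ρ₀,
            fderiv ℂ χ p (normalizedUpTo M l a₁ a₂ c D R p) = f p) ∧
          ∃ C' ≥ 0, ∀ p ∈ scaledDomain (j * l) γ₀ r₀ ρ₀,
            ‖χ p‖ ≤ C' * ‖p.1‖ ^ (m + 1) * ‖p.2‖ := by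
  have hj1 : j ≠ 0 := by rintro rfl; norm_num at hj
  set ν := j * l with hν
  have hν0 : ν ≠ 0 := mul_ne_zero hj1 hl
  set b := (a₂ - a₁) / 2 with hb
  set A := (a₁ + a₂) / 2 with hA
  have hA0 : 0 ≤ A.re := by
    rw [hA]
    simp only [Complex.div_ofNat_re]
    linarith
  obtain ⟨δ, hδ, hrad⟩ := exists_homological_radial hj0 hA0 hγ₀ hγ hγ₁
  have hl0 : 0 < ‖l‖ := norm_pos_iff.2 hl
  -- If the denominator is within μ of l, it is at least |l|/2 in modulus, so |G| ≤ 2 and |G − 1| ≤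
  -- μ/(|l|/2) ≤ δ.
  set μ := ‖l‖ * min (1 / 2) (δ / 2) with hμ
  have hμ0 : 0 < μ := mul_pos hl0 (lt_min (by norm_num) (by positivity))
  refine ⟨min (min 1 (t / 2)) (μ / (Lc + ‖b * ν‖ + 1)),
    lt_min (lt_min one_pos (by positivity)) (by positivity), ?_⟩
  rintro r₁ ⟨hr₁, hr₁'⟩ ρ₁ ⟨hρ₁, hρ₁'⟩ L hL M D R hM hD hR hDb hRb
  have hr1 : r₁ ≤ 1 := hr₁'.trans ((min_le_left _ _).trans (min_le_left _ _))
  have hρ1 : ρ₁ ≤ 1 := hρ₁'.trans ((min_le_left _ _).trans (min_le_left _ _))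
  have hρt : ρ₁ ≤ t / 2 := hρ₁'.trans ((min_le_left _ _).trans (min_le_right _ _))
  set ε := μ / (Lc + ‖b * ν‖ + 1) with hε
  have hrε : r₁ ≤ ε := hr₁'.trans (min_le_right _ _)
  have hρε : ρ₁ ≤ ε := hρ₁'.trans (min_le_right _ _)
  have hmaps : ∀ q ∈ cosDomain γ₁ r₁ ρ₁, ((ν * q.1, q.2) : Phase) ∈ scaledDomain ν γ₁ r₁ ρ₁ := by
    intro q hq
    simpa [scaledDomain, mul_div_cancel_left₀ _ hν0] using hq
  have hv : ∀ q ∈ cosDomain γ₁ r₁ ρ₁, ‖q.2.1 * q.2.2‖ ≤ ρ₁ := by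
    intro q hq
    refine norm_mul_snd_le.trans ?_
    nlinarith [hq.2, norm_nonneg q.2]
  have hvt : ∀ q ∈ cosDomain γ₁ r₁ ρ₁, q.2.1 * q.2.2 ∈ ball (0 : ℂ) t := by
    intro q hq
    rw [mem_ball_zero_iff]
    linarith [hv q hq]
  set den : Phase → ℂ := fun q => l + c (q.2.1 * q.2.2) + b * (ν * q.1) with hden
  have hsmall : ∀ q ∈ cosDomain γ₁ r₁ ρ₁, ‖den q - l‖ ≤ μ := by
    intro q hq
    have h1 : ‖c (q.2.1 * q.2.2)‖ ≤ Lc * ε := by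
      refine (hcb _ (hvt q hq)).trans ?_
      have := (hv q hq).trans hρε
      gcongr
    have h2 : ‖b * (ν * q.1)‖ ≤ ‖b * ν‖ * ε := by
      rw [← mul_assoc, norm_mul]
      have := hq.1.2.1.le.trans hrε
      gcongr
    have h3 : den q - l = c (q.2.1 * q.2.2) + b * (ν * q.1) := by rw [hden]; ring
    rw [h3]
    have h4 : (Lc + ‖b * ν‖ + 1) * ε = μ := by rw [hε]; field_simp
    have h5 : 0 < ε := hr₁.trans_le hrε
    linarith [norm_add_le (c (q.2.1 * q.2.2)) (b * (ν * q.1))]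
  have hμ1 : μ ≤ ‖l‖ / 2 := by
    have := mul_le_mul_of_nonneg_left (min_le_left (1 / 2 : ℝ) (δ / 2)) hl0.le
    linarith
  have hμ2 : μ ≤ ‖l‖ * (δ / 2) := mul_le_mul_of_nonneg_left (min_le_right _ _) hl0.le
  have hlow : ∀ q ∈ cosDomain γ₁ r₁ ρ₁, ‖l‖ / 2 ≤ ‖den q‖ := by
    intro q hq
    have := norm_sub_norm_le l (den q)
    rw [norm_sub_rev] at this
    linarith [hsmall q hq]
  have hden0 : ∀ q ∈ cosDomain γ₁ r₁ ρ₁, den q ≠ 0 := fun q hq =>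
    norm_pos_iff.1 (lt_of_lt_of_le (by positivity) (hlow q hq))
  set G : Phase → ℂ := fun q => l * (den q)⁻¹ with hG
  have hdend : DifferentiableOn ℂ den (cosDomain γ₁ r₁ ρ₁) := by
    have h1 : DifferentiableOn ℂ (fun q : Phase => c (q.2.1 * q.2.2)) (cosDomain γ₁ r₁ ρ₁) :=
      hcd.comp (f := fun q : Phase => q.2.1 * q.2.2) (by fun_prop) hvt
    exact (h1.const_add l).fun_add (by fun_prop)
  have hGd : DifferentiableOn ℂ G (cosDomain γ₁ r₁ ρ₁) :=
    (hdend.fun_inv hden0).const_mul l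
  have hG2 : ∀ q ∈ cosDomain γ₁ r₁ ρ₁, ‖G q‖ ≤ 2 := by
    intro q hq
    have h1 := hlow q hq
    rw [hG]
    simp only [norm_mul, norm_inv]
    rw [← div_eq_mul_inv, div_le_iff₀ (by linarith)]
    linarith
  have hGden : ∀ q ∈ cosDomain γ₁ r₁ ρ₁, G q * den q = l := fun q hq => by
    rw [hG]; simp only; rw [mul_assoc, inv_mul_cancel₀ (hden0 q hq), mul_one]
  have hGb : ∀ q ∈ cosDomain γ₁ r₁ ρ₁, ‖G q - 1‖ ≤ δ := by
    intro q hq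
    have h1 : G q - 1 = (l - den q) / den q := by
      rw [eq_div_iff (hden0 q hq), sub_mul, hGden q hq, one_mul]
    have h2 := hlow q hq
    rw [h1, norm_div, norm_sub_rev, div_le_iff₀ (by linarith)]
    nlinarith [hsmall q hq]
  have hscale : ∀ φ : Phase → ℂ, DifferentiableOn ℂ φ (scaledDomain ν γ₁ r₁ ρ₁) →
      DifferentiableOn ℂ (fun q : Phase => φ (ν * q.1, q.2)) (cosDomain γ₁ r₁ ρ₁) := fun φ hφ =>
    hφ.comp (f := fun q : Phase => ((ν * q.1, q.2) : Phase)) (by fun_prop) hmaps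
  have hgb : ∀ q ∈ cosDomain γ₁ r₁ ρ₁, ‖j * G q / l‖ ≤ ‖j‖ * 2 / ‖l‖ := by
    intro q hq
    rw [norm_div, norm_mul]
    have := hG2 q hq
    gcongr
  set C := ‖j‖ * 2 / ‖l‖ * ‖ν‖ ^ M * (2 * L) with hC
  have hBb : ∀ φ : Phase → ℂ, (∀ p ∈ scaledDomain ν γ₁ r₁ ρ₁, ‖φ p‖ ≤ 2 * L * ‖p.2‖) →
      ∀ q ∈ cosDomain γ₁ r₁ ρ₁,
        ‖j * G q / l * (ν * q.1) ^ M * φ (ν * q.1, q.2)‖ ≤ C * ‖q.1‖ ^ 2 := by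
    intro φ hφ q hq
    have h1 : ‖φ (ν * q.1, q.2)‖ ≤ 2 * L := by
      refine (hφ _ (hmaps q hq)).trans ?_
      have : ‖q.2‖ ≤ 1 := hq.2.le.trans hρ1
      nlinarith [norm_nonneg q.2]
    have h2 : ‖q.1‖ ^ M ≤ ‖q.1‖ ^ 2 :=
      pow_le_pow_of_le_one (norm_nonneg _) (hq.1.2.1.le.trans hr1) hM
    rw [norm_mul, norm_mul, norm_pow, norm_mul, mul_pow]
    calc ‖j * G q / l‖ * (‖ν‖ ^ M * ‖q.1‖ ^ M) * ‖φ (ν * q.1, q.2)‖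
        ≤ ‖j‖ * 2 / ‖l‖ * (‖ν‖ ^ M * ‖q.1‖ ^ 2) * (2 * L) := by
          have := hgb q hq
          gcongr
      _ = C * ‖q.1‖ ^ 2 := by rw [hC]; ring
  have hX : IsRadialData γ₁ r₁ ρ₁ δ C G
      (fun q => j * G q / l * (ν * q.1) ^ M * (R (ν * q.1, q.2) - D (ν * q.1, q.2)))
      (fun q => j * G q / l * (ν * q.1) ^ M * (R (ν * q.1, q.2) + D (ν * q.1, q.2))) := by
    have h1 := hscale D hD
    have h2 := hscale R hR
    have h3 : DifferentiableOn ℂ (fun q : Phase => j * G q / l * (ν * q.1) ^ M)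
        (cosDomain γ₁ r₁ ρ₁) := by fun_prop
    refine ⟨hGd, h3.fun_mul (h2.fun_sub h1), h3.fun_mul (h2.fun_add h1), hGb,
      hBb (fun p => R p - D p) (fun p hp => ?_), hBb (fun p => R p + D p) fun p hp => ?_⟩
    · linarith [norm_sub_le (R p) (D p), hDb p hp, hRb p hp]
    · linarith [norm_add_le (R p) (D p), hDb p hp, hRb p hp]
  obtain ⟨r₀, hr₀, ρ₀, hρ₀, K, hK, hsol⟩ := hrad r₁ hr₁ ρ₁ hρ₁ C (by positivity) _ _ _ hX
  refine ⟨r₀, hr₀, ρ₀, hρ₀, ?_⟩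
  intro f m Cf hCf hf hfb
  have hcsub : cosDomain γ₀ r₀ ρ₀ ⊆ cosDomain γ₁ r₁ ρ₁ := cosDomain_mono hγ.le hr₀.2 hρ₀.2
  -- The right-hand side receives the same unit as the field; the unit cancels once the equation is
  -- pulled back to x = νh.
  obtain ⟨χ, hχd, hχe, hχb⟩ := hsol (fun q => j * G q / l * f (ν * q.1, q.2)) m
    (‖j‖ * 2 / ‖l‖ * Cf * ‖ν‖ ^ (m + 2)) (by positivity)
    (DifferentiableOn.fun_mul (by fun_prop) (hscale f hf)) (fun q hq => by
      have h1 := hfb _ (hmaps q hq)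
      simp only [norm_mul ν, mul_pow] at h1
      rw [norm_mul]
      have h2 := hgb q hq
      calc ‖j * G q / l‖ * ‖f (ν * q.1, q.2)‖
          ≤ ‖j‖ * 2 / ‖l‖ * (Cf * (‖ν‖ ^ (m + 2) * ‖q.1‖ ^ (m + 2)) * ‖q.2‖) := by gcongr
        _ = _ := by ring)
  set S : Phase →L[ℂ] Phase := (ν⁻¹ • ContinuousLinearMap.fst ℂ ℂ (ℂ × ℂ)).prod
    (ContinuousLinearMap.snd ℂ ℂ (ℂ × ℂ)) with hS
  have hSp : ∀ p : Phase, S p = (p.1 / ν, p.2) := fun p => by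
    simp [hS, div_eq_inv_mul]
  have hmem : ∀ p ∈ scaledDomain ν γ₀ r₀ ρ₀, S p ∈ cosDomain γ₀ r₀ ρ₀ := fun p hp => by
    rw [hSp]; exact hp
  refine ⟨fun p => χ (S p), hχd.comp S.differentiable.differentiableOn hmem, fun p hp => ?_,
    ‖j‖ * 2 / ‖l‖ * Cf * ‖ν‖ ^ (m + 2) * K ^ (m + 3) * (‖ν‖⁻¹) ^ (m + 1), by positivity,
    fun p hp => ?_⟩
  · have hq := hmem p hp
    have hq1 := hcsub hq
    have hd : fderiv ℂ (fun p => χ (S p)) p = (fderiv ℂ χ (S p)).comp S := by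
      have := ((hχd.differentiableAt ((isOpen_cosDomain _ _ _).mem_nhds hq)).hasFDerivAt.comp p
        S.hasFDerivAt)
      exact this.fderiv
    have hback : ((ν * (S p).1, (S p).2) : Phase) = p := by
      rw [hSp]; simp [mul_div_cancel₀ _ hν0]
    have hg0 : j * G (S p) / l ≠ 0 := by
      have : G (S p) ≠ 0 := fun h0 => by
        have := hGden _ hq1
        rw [h0, zero_mul] at this
        exact hl this.symm
      exact div_ne_zero (mul_ne_zero hj1 this) hl
    have heq := hχe _ hq
    have hfield := radialField_eq_smul (a₁ := a₁) (a₂ := a₂) (M := M) (c := c) (D := D) (R := R)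
      (j := j) (h := (S p).1) (y := (S p).2) (G := G (S p)) hl hj (hGden _ hq1) rfl rfl
    rw [radialField, hfield, map_smul, smul_eq_mul] at heq
    simp only [← hν, hback] at heq
    rw [hd, ContinuousLinearMap.comp_apply, hSp (normalizedUpTo M l a₁ a₂ c D R p)]
    exact mul_left_cancel₀ hg0 heq
  · refine (hχb _ (hmem p hp)).trans (le_of_eq ?_)
    rw [hSp]
    rw [norm_div, div_eq_mul_inv ‖p.1‖, mul_pow]
    ring

end Homological

/-! ### Solving for the two exponents -/

section Exponents

theorem exists_lipschitz_of_analyticAt {c : ℂ → ℂ} (hc : AnalyticAt ℂ c 0) :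
    ∃ t > 0, ∃ L ≥ 0, DifferentiableOn ℂ c (ball 0 t) ∧
      ∀ z ∈ ball (0 : ℂ) t, ∀ w ∈ ball (0 : ℂ) t, ‖c z - c w‖ ≤ L * ‖z - w‖ := by
  obtain ⟨K, s, hs, hK⟩ := hc.hasStrictFDerivAt.exists_lipschitzOnWith
  obtain ⟨t, ht, hsub⟩ := Metric.mem_nhds_iff.1 (inter_mem hs hc.eventually_analyticAt)
  exact ⟨t, ht, K, K.2, fun z hz => (hsub hz).2.differentiableAt.differentiableWithinAt,
    fun z hz w hw => hK.norm_sub_le (hsub hz).1 (hsub hw).1⟩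

/-- The exponents `χ₁`, `χ₂` of a conjugacy `(x, y₁ e^{χ₁}, y₂ e^{χ₂})` to the normal form. -/
theorem exists_exponents {l a₁ a₂ j : ℂ} (hl : l ≠ 0) (hj : j ^ 2 = -1) (hj0 : j.re = 0)
    (ha : 0 ≤ (a₁ + a₂).re) {γ₀ γ₁ r₁ ρ₁ L : ℝ} (hγ₀ : 0 ≤ γ₀) (hγ : γ₀ < γ₁) (hγ₁ : γ₁ < 1)
    (hr₁ : 0 < r₁) (hρ₁ : 0 < ρ₁) (hL : 0 ≤ L) {n : ℕ} {c : ℂ → ℂ} (hc : AnalyticAt ℂ c 0)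
    (hc0 : c 0 = 0) {D R : Phase → ℂ}
    (hD : DifferentiableOn ℂ D (scaledDomain (j * l) γ₁ r₁ ρ₁))
    (hR : DifferentiableOn ℂ R (scaledDomain (j * l) γ₁ r₁ ρ₁))
    (hDb : ∀ p ∈ scaledDomain (j * l) γ₁ r₁ ρ₁, ‖D p‖ ≤ L * ‖p.2‖)
    (hRb : ∀ p ∈ scaledDomain (j * l) γ₁ r₁ ρ₁, ‖R p‖ ≤ L * ‖p.2‖) :
    ∃ r₀ ∈ Ioc 0 r₁, ∃ ρ₀ ∈ Ioc 0 ρ₁, ∃ χ₁ χ₂ : Phase → ℂ,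
      DifferentiableOn ℂ χ₁ (scaledDomain (j * l) γ₀ r₀ ρ₀) ∧
      DifferentiableOn ℂ χ₂ (scaledDomain (j * l) γ₀ r₀ ρ₀) ∧
      (∀ p ∈ scaledDomain (j * l) γ₀ r₀ ρ₀,
        fderiv ℂ χ₁ p (normalizedUpTo (n + 3) l a₁ a₂ c D R p) = p.1 ^ (n + 3) * (D p - R p) +
          (c (p.2.1 * p.2.2) - c (p.2.1 * p.2.2 * Complex.exp (χ₁ p + χ₂ p)))) ∧
      (∀ p ∈ scaledDomain (j * l) γ₀ r₀ ρ₀,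
        fderiv ℂ χ₂ p (normalizedUpTo (n + 3) l a₁ a₂ c D R p) = -p.1 ^ (n + 3) * (D p + R p) -
          (c (p.2.1 * p.2.2) - c (p.2.1 * p.2.2 * Complex.exp (χ₁ p + χ₂ p)))) ∧
      ∃ C ≥ 0, ∀ p ∈ scaledDomain (j * l) γ₀ r₀ ρ₀,
        ‖χ₁ p‖ ≤ C * ‖p.1‖ ^ (n + 1) * ‖p.2‖ ∧ ‖χ₂ p‖ ≤ C * ‖p.1‖ ^ (n + 1) * ‖p.2‖ := by
  have hj1 : j ≠ 0 := by rintro rfl; norm_num at hj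
  set ν := j * l with hν
  have hν0 : ν ≠ 0 := mul_ne_zero hj1 hl
  have hνn : 0 < ‖ν‖ := norm_pos_iff.2 hν0
  obtain ⟨t, ht, Lc, hLc, hcd, hcl⟩ := exists_lipschitz_of_analyticAt hc
  have hcb : ∀ z ∈ ball (0 : ℂ) t, ‖c z‖ ≤ Lc * ‖z‖ := fun z hz => by
    simpa [hc0] using hcl z hz 0 (mem_ball_self ht)
  -- Two homological equations are solved in succession, each narrowing the sector.
  set γ := (γ₀ + γ₁) / 2 with hγm
  obtain ⟨ε₁, hε₁, H₁⟩ := exists_homological (a₁ := a₁) (a₂ := a₂) (γ₀ := γ) (γ₁ := γ₁) hl hj hj0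
    ha (by linarith) (by linarith) hγ₁ ht hLc hcd hcb
  obtain ⟨ε₂, hε₂, H₂⟩ := exists_homological (a₁ := a₁) (a₂ := a₂) (γ₀ := γ₀) (γ₁ := γ) hl hj hj0
    ha hγ₀ (by linarith) (by linarith) ht hLc hcd hcb
  have hsub₁ : scaledDomain ν γ₁ (min r₁ ε₁) (min ρ₁ ε₁) ⊆ scaledDomain ν γ₁ r₁ ρ₁ :=
    scaledDomain_mono le_rfl (min_le_left _ _) (min_le_left _ _)
  obtain ⟨r₂, hr₂, ρ₂, hρ₂, hsol₁⟩ := H₁ (min r₁ ε₁) ⟨lt_min hr₁ hε₁, min_le_right _ _⟩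
    (min ρ₁ ε₁) ⟨lt_min hρ₁ hε₁, min_le_right _ _⟩ L hL (n + 3) D R (by omega) (hD.mono hsub₁)
    (hR.mono hsub₁) (fun p hp => hDb p (hsub₁ hp)) (fun p hp => hRb p (hsub₁ hp))
  -- Here s is the sum χ₁ + χ₂, in whose equation the c-terms cancel; it is O(x^{n+2}‖y‖).
  obtain ⟨s, hsd, hse, Cs, hCs, hsb⟩ := hsol₁ (fun p => -2 * p.1 ^ (n + 3) * R p) (n + 1) (2 * L)
    (by positivity) (DifferentiableOn.fun_mul (by fun_prop) (hR.mono hsub₁)) (fun p hp => by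
      have := hRb p (hsub₁ hp)
      rw [norm_mul, norm_mul, norm_pow, norm_neg, Complex.norm_ofNat]
      calc 2 * ‖p.1‖ ^ (n + 3) * ‖R p‖ ≤ 2 * ‖p.1‖ ^ (n + 3) * (L * ‖p.2‖) := by gcongr
        _ = _ := by ring)
  have hr₂0 := hr₂.1
  set E := Cs * (‖ν‖ * r₂) ^ (n + 2) with hE
  have hE0 : 0 ≤ E := by positivity
  -- The bound 1/(E + 1) gives |s| ≤ 1, hence |e^s| ≤ 3, and t/4 then keeps v e^s in the disc of
  -- radius t where c is Lipschitz.
  set ρ₃ := min (min ρ₂ ε₂) (min (min 1 (t / 4)) (1 / (E + 1))) with hρ₃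
  have hρ₃0 : 0 < ρ₃ := lt_min (lt_min hρ₂.1 hε₂) (lt_min (lt_min one_pos (by positivity))
    (by positivity))
  have hρ₃1 : ρ₃ ≤ 1 := (min_le_right _ _).trans ((min_le_left _ _).trans (min_le_left _ _))
  have hρ₃t : ρ₃ ≤ t / 4 := (min_le_right _ _).trans ((min_le_left _ _).trans (min_le_right _ _))
  have hρ₃E : E * ρ₃ ≤ 1 := by
    calc E * ρ₃ ≤ (E + 1) * (1 / (E + 1)) := by
          gcongr
          · linarith
          · exact (min_le_right _ _).trans (min_le_right _ _)
      _ = 1 := by field_simp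
  set r₃ := min r₂ ε₂ with hr₃
  have hr₃0 : 0 < r₃ := lt_min hr₂.1 hε₂
  have hρ₃2 : ρ₃ ≤ ρ₂ := (min_le_left _ _).trans (min_le_left _ _)
  have hsub₂ : scaledDomain ν γ r₃ ρ₃ ⊆ scaledDomain ν γ r₂ ρ₂ :=
    scaledDomain_mono le_rfl (min_le_left _ _) hρ₃2
  have hsub₃ : scaledDomain ν γ r₃ ρ₃ ⊆ scaledDomain ν γ₁ r₁ ρ₁ :=
    scaledDomain_mono (by linarith) ((min_le_left _ _).trans (hr₂.2.trans (min_le_left _ _)))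
      (hρ₃2.trans (hρ₂.2.trans (min_le_left _ _)))
  have hs1 : ∀ p ∈ scaledDomain ν γ r₃ ρ₃, ‖s p‖ ≤ 1 := by
    intro p hp
    refine (hsb p (hsub₂ hp)).trans ?_
    have h1 := (norm_fst_lt_of_mem_scaledDomain hν0 (hsub₂ hp)).le
    have h2 : ‖p.2‖ ≤ ρ₃ := hp.2.le
    calc Cs * ‖p.1‖ ^ (n + 1 + 1) * ‖p.2‖ ≤ Cs * (‖ν‖ * r₂) ^ (n + 1 + 1) * ρ₃ := by gcongr
      _ ≤ 1 := hρ₃E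
  have hv : ∀ p ∈ scaledDomain ν γ r₃ ρ₃, ‖p.2.1 * p.2.2‖ ≤ ρ₃ := by
    intro p hp
    refine norm_mul_snd_le.trans ?_
    have h2 : ‖p.2‖ ≤ ρ₃ := hp.2.le
    nlinarith [norm_nonneg p.2]
  have hvt : ∀ p ∈ scaledDomain ν γ r₃ ρ₃, p.2.1 * p.2.2 ∈ ball (0 : ℂ) t := by
    intro p hp
    rw [mem_ball_zero_iff]
    linarith [hv p hp]
  have hes : ∀ p ∈ scaledDomain ν γ r₃ ρ₃, ‖Complex.exp (s p) - 1‖ ≤ 2 * ‖s p‖ := fun p hp =>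
    Complex.norm_exp_sub_one_le (hs1 p hp)
  have hvt' : ∀ p ∈ scaledDomain ν γ r₃ ρ₃,
      p.2.1 * p.2.2 * Complex.exp (s p) ∈ ball (0 : ℂ) t := by
    intro p hp
    rw [mem_ball_zero_iff, norm_mul]
    have h1 : ‖Complex.exp (s p)‖ ≤ 3 := by
      have := norm_add_le (Complex.exp (s p) - 1) 1
      rw [sub_add_cancel, norm_one] at this
      linarith [hes p hp, hs1 p hp]
    have h2 := hv p hp
    have := mul_le_mul h2 h1 (norm_nonneg _) hρ₃0.le
    linarith
  have hsd₃ := hsd.mono hsub₂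
  set f : Phase → ℂ := fun p => p.1 ^ (n + 3) * (D p - R p) +
    (c (p.2.1 * p.2.2) - c (p.2.1 * p.2.2 * Complex.exp (s p))) with hf
  have hfd : DifferentiableOn ℂ f (scaledDomain ν γ r₃ ρ₃) := by
    have h1 : DifferentiableOn ℂ (fun p : Phase => c (p.2.1 * p.2.2))
        (scaledDomain ν γ r₃ ρ₃) :=
      hcd.comp (f := fun p : Phase => p.2.1 * p.2.2) (by fun_prop) hvt
    have h2 : DifferentiableOn ℂ (fun p : Phase => c (p.2.1 * p.2.2 * Complex.exp (s p)))
        (scaledDomain ν γ r₃ ρ₃) :=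
      hcd.comp (f := fun p : Phase => p.2.1 * p.2.2 * Complex.exp (s p))
        (DifferentiableOn.fun_mul (by fun_prop) hsd₃.cexp) hvt'
    exact (DifferentiableOn.fun_mul (by fun_prop)
      ((hD.mono hsub₃).fun_sub (hR.mono hsub₃))).fun_add (h1.fun_sub h2)
  -- The difference c(v) − c(v e^s) is only of the order of s, so f has order n + 2 in x: this is
  -- the second power of x lost on the way to χ₁ = O(x^{n+1}‖y‖).
  have hfb : ∀ p ∈ scaledDomain ν γ r₃ ρ₃,
      ‖f p‖ ≤ (‖ν‖ * r₂ * (2 * L) + Lc * (2 * Cs)) * ‖p.1‖ ^ (n + 2) * ‖p.2‖ := by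
    intro p hp
    have h1 := (norm_fst_lt_of_mem_scaledDomain hν0 (hsub₂ hp)).le
    have h2 : ‖D p - R p‖ ≤ 2 * L * ‖p.2‖ := by
      linarith [norm_sub_le (D p) (R p), hDb p (hsub₃ hp), hRb p (hsub₃ hp)]
    have h3 : ‖p.1 ^ (n + 3) * (D p - R p)‖ ≤
        ‖ν‖ * r₂ * (2 * L) * ‖p.1‖ ^ (n + 2) * ‖p.2‖ := by
      rw [norm_mul, norm_pow]
      calc ‖p.1‖ ^ (n + 3) * ‖D p - R p‖
          = ‖p.1‖ * ‖p.1‖ ^ (n + 2) * ‖D p - R p‖ := by ring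
        _ ≤ ‖ν‖ * r₂ * ‖p.1‖ ^ (n + 2) * (2 * L * ‖p.2‖) := by gcongr
        _ = _ := by ring
    have h4 : ‖c (p.2.1 * p.2.2) - c (p.2.1 * p.2.2 * Complex.exp (s p))‖ ≤
        Lc * (2 * Cs) * ‖p.1‖ ^ (n + 2) * ‖p.2‖ := by
      refine (hcl _ (hvt p hp) _ (hvt' p hp)).trans ?_
      have h5 : p.2.1 * p.2.2 - p.2.1 * p.2.2 * Complex.exp (s p) =
          -(p.2.1 * p.2.2 * (Complex.exp (s p) - 1)) := by ring
      rw [h5, norm_neg, norm_mul]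
      have h6 := (hv p hp).trans hρ₃1
      have h7 := (hes p hp).trans
        (mul_le_mul_of_nonneg_left (hsb p (hsub₂ hp)) zero_le_two)
      calc Lc * (‖p.2.1 * p.2.2‖ * ‖Complex.exp (s p) - 1‖)
          ≤ Lc * (1 * (2 * (Cs * ‖p.1‖ ^ (n + 1 + 1) * ‖p.2‖))) := by gcongr
        _ = _ := by ring
    refine (norm_add_le _ _).trans ((add_le_add h3 h4).trans (le_of_eq ?_))
    ring
  obtain ⟨r₀, hr₀, ρ₀, hρ₀, hsol₂⟩ := H₂ r₃ ⟨hr₃0, min_le_right _ _⟩ ρ₃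
    ⟨hρ₃0, (min_le_left _ _).trans (min_le_right _ _)⟩ L hL (n + 3) D R (by omega) (hD.mono hsub₃)
    (hR.mono hsub₃) (fun p hp => hDb p (hsub₃ hp)) (fun p hp => hRb p (hsub₃ hp))
  obtain ⟨χ, hχd, hχe, C, hC, hχb⟩ := hsol₂ f n _ (by positivity) hfd hfb
  have hsub₀ : scaledDomain ν γ₀ r₀ ρ₀ ⊆ scaledDomain ν γ r₃ ρ₃ :=
    scaledDomain_mono (by linarith) hr₀.2 hρ₀.2
  have hsd₀ := hsd₃.mono hsub₀
  refine ⟨r₀, ⟨hr₀.1, hr₀.2.trans ((min_le_left _ _).trans (hr₂.2.trans (min_le_left _ _)))⟩, ρ₀,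
    ⟨hρ₀.1, hρ₀.2.trans (hρ₃2.trans (hρ₂.2.trans (min_le_left _ _)))⟩, χ, fun p => s p - χ p, hχd,
    hsd₀.fun_sub hχd, fun p hp => ?_, fun p hp => ?_, C + Cs * (‖ν‖ * r₂), by positivity,
    fun p hp => ⟨?_, ?_⟩⟩
  · rw [hχe p hp, add_sub_cancel]
  · have hnh := (isOpen_scaledDomain ν γ₀ r₀ ρ₀).mem_nhds hp
    rw [fderiv_fun_sub (hsd₀.differentiableAt hnh) (hχd.differentiableAt hnh),
      sub_apply, hχe p hp, hse p (hsub₂ (hsub₀ hp)), add_sub_cancel]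
    simp only [hf]
    ring
  · refine (hχb p hp).trans ?_
    have : 0 ≤ Cs * (‖ν‖ * r₂) := by positivity
    gcongr
    linarith
  · have h1 := (norm_fst_lt_of_mem_scaledDomain hν0 (hsub₂ (hsub₀ hp))).le
    have h2 := hsb p (hsub₂ (hsub₀ hp))
    have h3 : Cs * ‖p.1‖ ^ (n + 1 + 1) * ‖p.2‖ ≤
        Cs * (‖ν‖ * r₂) * ‖p.1‖ ^ (n + 1) * ‖p.2‖ := by
      calc Cs * ‖p.1‖ ^ (n + 1 + 1) * ‖p.2‖ = Cs * ‖p.1‖ * ‖p.1‖ ^ (n + 1) * ‖p.2‖ := by ring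
        _ ≤ _ := by gcongr
    linarith [norm_sub_le (s p) (χ p), hχb p hp]

end Exponents

/-! ### Angular sectors as cosine sectors -/

section Sectors

/-- After division by ν the condition is |arg| < β, equivalent to cos(arg) > cos β because cosine
decreases on [0, π]. -/
theorem mem_sector_iff {ν x : ℂ} (hν : ν ≠ 0) {r β : ℝ} (hβ0 : 0 < β) (hβ : β < Real.pi) :
    x ∈ sector r (ν.arg - β) (ν.arg + β) ↔ x / ν ∈ cosSector (-Real.cos β) (r / ‖ν‖) := by
  have hνn : 0 < ‖ν‖ := norm_pos_iff.2 hν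
  have hνe := Complex.norm_mul_exp_arg_mul_I ν
  simp only [sector, cosSector, mem_ofPred_eq, norm_div, neg_neg]
  rw [div_pos_iff_of_pos_right hνn, div_lt_div_iff_of_pos_right hνn]
  refine and_congr_right fun hx => and_congr_right fun _ => ⟨?_, fun h => ?_⟩
  · rintro ⟨t, ht, hxt⟩
    have hq : x / ν = ((‖x‖ / ‖ν‖ : ℝ) : ℂ) * Complex.exp ((t - ν.arg : ℝ) * Complex.I) := by
      rw [div_eq_iff hν]
      nth_rewrite 3 [← hνe]
      nth_rewrite 1 [hxt]
      have : ((‖ν‖ : ℝ) : ℂ) ≠ 0 := by exact_mod_cast hνn.ne'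
      have h2 : Complex.exp (t * Complex.I) =
          Complex.exp ((t - ν.arg : ℝ) * Complex.I) * Complex.exp (ν.arg * Complex.I) := by
        rw [← Complex.exp_add]; congr 1; push_cast; ring
      rw [h2]
      push_cast
      field_simp
    rw [hq, Complex.re_ofReal_mul, Complex.exp_ofReal_mul_I_re, mul_comm]
    refine mul_lt_mul_of_pos_left ?_ (by positivity)
    rw [← Real.cos_abs (t - ν.arg)]
    refine Real.cos_lt_cos_of_nonneg_of_le_pi (abs_nonneg _) hβ.le ?_
    rw [abs_lt]
    constructor <;> linarith [ht.1, ht.2]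
  · set h' := x / ν with hh'
    have hxne : x ≠ 0 := norm_pos_iff.1 hx
    have hne : h' ≠ 0 := div_ne_zero hxne hν
    have hn : 0 < ‖h'‖ := norm_pos_iff.2 hne
    have habs : |h'.arg| < β := by
      by_contra hcon
      push Not at hcon
      have h1 := Real.cos_le_cos_of_nonneg_of_le_pi hβ0.le (Complex.abs_arg_le_pi h') hcon
      rw [Real.cos_abs, Complex.cos_arg hne, div_le_iff₀ hn] at h1
      rw [hh', norm_div] at h1
      linarith
    rw [abs_lt] at habs
    refine ⟨ν.arg + h'.arg, ⟨by linarith [habs.1], by linarith [habs.2]⟩, ?_⟩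
    have h3 : x = ν * h' := by rw [hh']; field_simp
    have h4 := Complex.norm_mul_exp_arg_mul_I h'
    rw [h3, norm_mul]
    conv_lhs => rw [← hνe, ← h4]
    push_cast
    rw [add_mul, Complex.exp_add]
    ring

theorem sector_prod_polydisc {ν : ℂ} (hν : ν ≠ 0) {r β ρ : ℝ} (hβ0 : 0 < β) (hβ : β < Real.pi) :
    sector r (ν.arg - β) (ν.arg + β) ×ˢ polydisc ρ ρ =
      scaledDomain ν (-Real.cos β) (r / ‖ν‖) ρ := by
  ext p
  rw [mem_prod, mem_sector_iff hν hβ0 hβ]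
  simp only [scaledDomain, cosDomain, polydisc, mem_ofPred_eq, Prod.norm_def, max_lt_iff]

theorem sector_mono {r r' α α' β β' : ℝ} (hr : r ≤ r') (hα : α' ≤ α) (hβ : β ≤ β') :
    sector r α β ⊆ sector r' α' β' := by
  rintro x ⟨h1, h2, t, ht, h3⟩
  exact ⟨h1, h2.trans_le hr, t, ⟨hα.trans_lt ht.1, ht.2.trans_le hβ⟩, h3⟩

/-- All smaller angles and radii are allowed so that D and R, given on unrelated neighbourhoods, can
be restricted to a common domain. -/
theorem IsSectorialRemainder.exists_scaledDomain {ν : ℂ} (hν : ν ≠ 0) {η : ℝ}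
    {f : Phase → ℂ} (hf : IsSectorialRemainder ν.arg η f) :
    ∃ β₀ > η / 2, ∃ r₀ > 0, ∃ ρ₀ > 0, ∃ L ≥ 0, ∀ β ≤ β₀, 0 < β → β < Real.pi → ∀ r ≤ r₀, ∀ ρ ≤ ρ₀,
      DifferentiableOn ℂ f (scaledDomain ν (-Real.cos β) r ρ) ∧
        ∀ p ∈ scaledDomain ν (-Real.cos β) r ρ, ‖f p‖ ≤ L * ‖p.2‖ := by
  obtain ⟨S, ⟨-, r, hr, ρ₁, hρ₁, ρ₂, hρ₂, ε, hε, hsub⟩, hd, L, hL⟩ := hf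
  have hνn : 0 < ‖ν‖ := norm_pos_iff.2 hν
  refine ⟨η / 2 + ε, by linarith, r / ‖ν‖, by positivity, min ρ₁ ρ₂, lt_min hρ₁ hρ₂, |L|,
    abs_nonneg L, ?_⟩
  intro β hβ hβ0 hβπ r' hr' ρ hρ
  have hmem : scaledDomain ν (-Real.cos β) r' ρ ⊆ S := by
    refine (scaledDomain_mono le_rfl hr' le_rfl).trans ?_
    rw [← sector_prod_polydisc hν hβ0 hβπ]
    refine (prod_mono (sector_mono le_rfl (by linarith) (by linarith)) ?_).trans hsub
    exact fun y hy => ⟨hy.1.trans_le (hρ.trans (min_le_left _ _)),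
      hy.2.trans_le (hρ.trans (min_le_right _ _))⟩
  refine ⟨hd.mono hmem, fun p hp => (hL p (hmem hp)).trans ?_⟩
  gcongr
  exact le_abs_self L

end Sectors

/-! ### Fibered maps close to the identity -/

section Diffeomorphism

/-- A fibered holomorphic map that is a small perturbation of the identity in each fibre is a
biholomorphism onto its image. -/
theorem exists_openPartialHomeomorph {U : Set Phase} (hU : IsOpen U) {Ψ : Phase → Phase}
    (hΨ : DifferentiableOn ℂ Ψ U) (hfib : ∀ p, (Ψ p).1 = p.1)
    (hlip : ∀ p ∈ U, ∀ q ∈ U, p.1 = q.1 →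
      ‖((Ψ p).2 - p.2) - ((Ψ q).2 - q.2)‖ ≤ 1 / 2 * ‖p.2 - q.2‖) :
    ∃ e : OpenPartialHomeomorph Phase Phase, e.source = U ∧ ⇑e = Ψ ∧
      DifferentiableOn ℂ e.symm e.target := by
  have hinj : InjOn Ψ U := by
    intro p hp q hq hpq
    have h1 : p.1 = q.1 := by rw [← hfib p, ← hfib q, hpq]
    have h2 := hlip p hp q hq h1
    rw [hpq] at h2
    have h3 : ((Ψ q).2 - p.2) - ((Ψ q).2 - q.2) = -(p.2 - q.2) := by abel
    rw [h3, norm_neg] at h2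
    have h4 : ‖p.2 - q.2‖ = 0 := by linarith [norm_nonneg (p.2 - q.2)]
    exact Prod.ext h1 (sub_eq_zero.1 (norm_eq_zero.1 h4))
  -- The differential is block triangular, with 1 on the base and a fibre block within 1/2 of the
  -- identity, so it is injective, hence invertible in finite dimension.
  have hequiv : ∀ p ∈ U, ∃ L : Phase ≃L[ℂ] Phase, (L : Phase →L[ℂ] Phase) = fderiv ℂ Ψ p := by
    intro p hp
    have hd := (hΨ.differentiableAt (hU.mem_nhds hp)).hasFDerivAt
    set L := fderiv ℂ Ψ p with hL
    have hLfst : ∀ w, (L w).1 = w.1 := by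
      intro w
      have h1 : HasFDerivAt (fun q => (Ψ q).1) ((ContinuousLinearMap.fst ℂ ℂ (ℂ × ℂ)).comp L) p :=
        hasFDerivAt_fst.comp p hd
      simp only [hfib] at h1
      have h2 := congrArg (fun T : Phase →L[ℂ] ℂ => T w) (h1.unique hasFDerivAt_fst)
      simpa using h2
    have hLin : Function.Injective (L : Phase →ₗ[ℂ] Phase) := by
      rw [← LinearMap.ker_eq_bot, LinearMap.ker_eq_bot']
      intro w hw
      have hw0 : L w = 0 := hw
      have hw1 : w.1 = 0 := by rw [← hLfst w, hw0]; rfl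
      have hi : HasFDerivAt (fun y : ℂ × ℂ => ((p.1, y) : Phase))
          (ContinuousLinearMap.inr ℂ ℂ (ℂ × ℂ)) p.2 := hasFDerivAt_prodMk_right p.1 p.2
      have h1 : HasFDerivAt (fun y : ℂ × ℂ => (Ψ (p.1, y)).2 - y)
          (((ContinuousLinearMap.snd ℂ ℂ (ℂ × ℂ)).comp
            (L.comp (ContinuousLinearMap.inr ℂ ℂ (ℂ × ℂ)))) -
            ContinuousLinearMap.id ℂ (ℂ × ℂ)) p.2 :=
        (hasFDerivAt_snd.comp p.2 (hd.comp p.2 hi)).sub (hasFDerivAt_id _)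
      have h2 := h1.le_of_lip' (C := 1 / 2) (by norm_num) (by
        have hcont : Continuous fun y : ℂ × ℂ => ((p.1, y) : Phase) := by fun_prop
        filter_upwards [hcont.continuousAt.preimage_mem_nhds (hU.mem_nhds hp)] with y hy
        exact hlip (p.1, y) hy p hp rfl)
      have h3 := ContinuousLinearMap.le_of_opNorm_le _ h2 w.2
      have h4 : ((0, w.2) : Phase) = w := Prod.ext hw1.symm rfl
      simp only [sub_apply, ContinuousLinearMap.comp_apply,
        ContinuousLinearMap.inr_apply, ContinuousLinearMap.coe_snd', ContinuousLinearMap.id_apply,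
        h4, hw0, Prod.snd_zero, zero_sub, norm_neg] at h3
      have h5 : ‖w.2‖ = 0 := by linarith [norm_nonneg w.2]
      exact Prod.ext hw1 (norm_eq_zero.1 h5)
    refine ⟨(LinearEquiv.ofInjectiveEndo _ hLin).toContinuousLinearEquiv, ?_⟩
    ext <;> rfl
  have hopen : IsOpenMap (U.domRestrict Ψ) := by
    rw [isOpenMap_iff_nhds_le]
    rintro ⟨p, hp⟩
    obtain ⟨L, hL⟩ := hequiv p hp
    have h1 := hasStrictFDerivAt_of_differentiableOn hU hΨ hp
    rw [← hL] at h1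
    have h2 : map (U.domRestrict Ψ) (𝓝 ⟨p, hp⟩) = map Ψ (𝓝 p) := by
      rw [← map_nhds_subtype_coe_eq_nhds hp (hU.mem_nhds hp), map_map]
      rfl
    rw [h2, h1.map_nhds_eq_of_equiv]
    rfl
  refine ⟨OpenPartialHomeomorph.ofContinuousOpenRestrict (hinj.toPartialEquiv Ψ U)
    hΨ.continuousOn hopen hU, rfl, rfl, fun q hq => ?_⟩
  set e := OpenPartialHomeomorph.ofContinuousOpenRestrict (hinj.toPartialEquiv Ψ U)
    hΨ.continuousOn hopen hU
  have hp : e.symm q ∈ U := e.map_target hq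
  obtain ⟨L, hL⟩ := hequiv _ hp
  have h1 := (hΨ.differentiableAt (hU.mem_nhds hp)).hasFDerivAt
  rw [← hL] at h1
  exact (e.hasFDerivAt_symm hq h1).differentiableAt.differentiableWithinAt

/-- The map `(x, y₁, y₂) ↦ (x, y₁ e^{χ₁}, y₂ e^{χ₂})`. -/
def expMap (χ₁ χ₂ : Phase → ℂ) (p : Phase) : Phase :=
  (p.1, p.2.1 * Complex.exp (χ₁ p), p.2.2 * Complex.exp (χ₂ p))

theorem fderiv_expMap_apply {χ₁ χ₂ : Phase → ℂ} {p : Phase} (h1 : DifferentiableAt ℂ χ₁ p)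
    (h2 : DifferentiableAt ℂ χ₂ p) (w : Phase) :
    fderiv ℂ (expMap χ₁ χ₂) p w =
      (w.1, Complex.exp (χ₁ p) * (w.2.1 + p.2.1 * fderiv ℂ χ₁ p w),
        Complex.exp (χ₂ p) * (w.2.2 + p.2.2 * fderiv ℂ χ₂ p w)) := by
  have hy1 : HasFDerivAt (fun p : Phase => p.2.1) ((ContinuousLinearMap.fst ℂ ℂ ℂ).comp
      (ContinuousLinearMap.snd ℂ ℂ (ℂ × ℂ))) p := hasFDerivAt_fst.comp p hasFDerivAt_snd
  have hy2 : HasFDerivAt (fun p : Phase => p.2.2) ((ContinuousLinearMap.snd ℂ ℂ ℂ).comp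
      (ContinuousLinearMap.snd ℂ ℂ (ℂ × ℂ))) p := hasFDerivAt_snd.comp p hasFDerivAt_snd
  have hd : HasFDerivAt (expMap χ₁ χ₂) _ p := (hasFDerivAt_fst (p := p)).prodMk
    ((hy1.mul h1.hasFDerivAt.cexp).prodMk (hy2.mul h2.hasFDerivAt.cexp))
  rw [hd.fderiv]
  simp only [ContinuousLinearMap.prod_apply, ContinuousLinearMap.coe_fst', add_apply,
    smul_apply, ContinuousLinearMap.comp_apply,
    ContinuousLinearMap.coe_snd', smul_eq_mul]
  refine Prod.ext rfl (Prod.ext ?_ ?_) <;> simp only <;> ring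

theorem norm_expMap_snd_sub_le {χ₁ χ₂ : Phase → ℂ} {p : Phase} {B : ℝ} (h1 : ‖χ₁ p‖ ≤ B)
    (h2 : ‖χ₂ p‖ ≤ B) (hB : B ≤ 1) : ‖(expMap χ₁ χ₂ p).2 - p.2‖ ≤ 2 * B * ‖p.2‖ := by
  have hB0 : 0 ≤ B := (norm_nonneg _).trans h1
  have key : ∀ y z : ℂ, ‖y‖ ≤ ‖p.2‖ → ‖z‖ ≤ B → ‖y * Complex.exp z - y‖ ≤ 2 * B * ‖p.2‖ := by
    intro y z hy hz
    have h3 := Complex.norm_exp_sub_one_le (hz.trans hB)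
    have h4 : y * Complex.exp z - y = (Complex.exp z - 1) * y := by ring
    rw [h4, norm_mul]
    have h5 : ‖Complex.exp z - 1‖ ≤ 2 * B := h3.trans (by linarith)
    gcongr
  exact norm_prod_le_iff.2 ⟨key _ _ (norm_fst_le _) h1, key _ _ (norm_snd_le _) h2⟩

end Diffeomorphism

end SaddleNode

end

/-! ### Assembly of the sectorial conjugacies -/

theorem mainTheorem6 (l a₁ a₂ : ℂ) (hl : l ≠ 0) (ha : 0 < (a₁ + a₂).re)
    (N : ℕ) (hN : 0 < N) (c : ℂ → ℂ) (hc : AnalyticAt ℂ c 0) (hc0 : c 0 = 0)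
    (D R : ℤˣ → SaddleNode.Phase → ℂ)
    (η : ℝ) (hη : η ∈ Set.Ioo Real.pi (2 * Real.pi))
    (hD : ∀ σ : ℤˣ, SaddleNode.IsSectorialRemainder (SaddleNode.direction l σ) η (D σ))
    (hR : ∀ σ : ℤˣ, SaddleNode.IsSectorialRemainder (SaddleNode.direction l σ) η (R σ)) :
    ∀ σ : ℤˣ, ∃ Ψ : OpenPartialHomeomorph SaddleNode.Phase SaddleNode.Phase,
      SaddleNode.IsSectorialDiffeo (SaddleNode.direction l σ) η Ψ ∧
      Set.EqOn
        (SaddleNode.pushforward Ψ (SaddleNode.normalizedUpTo (N + 2) l a₁ a₂ c (D σ) (R σ)))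
        (SaddleNode.normalForm l a₁ a₂ c) Ψ.target ∧
      (∃ K : ℝ, ∀ p ∈ Ψ.source, ‖(Ψ p).2 - p.2‖ ≤ K * ‖p.2‖ ^ 2) ∧
      ∃ r > 0, ∃ ε ∈ Set.Ioo 0 (Real.pi / 2), η < Real.pi + 2 * ε ∧
        ∃ ρ₁ > 0, ∃ ρ₂ > 0, ∃ P : SaddleNode.Phase → ℂ × ℂ, ∃ K : ℝ,
          Ψ.source = SaddleNode.wideSector l σ r ε ×ˢ SaddleNode.polydisc ρ₁ ρ₂ ∧
          DifferentiableOn ℂ P Ψ.source ∧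
          (∀ p ∈ Ψ.source, Ψ p = p + p.1 ^ N • ((0, P p) : SaddleNode.Phase)) ∧
          ∀ p ∈ Ψ.source, ‖P p‖ ≤ K * ‖p.2‖ ^ 2 := by
  open SaddleNode Metric in
  intro σ
  obtain ⟨n, rfl⟩ : ∃ n, N = n + 1 := ⟨N - 1, by omega⟩
  have hπ := Real.pi_pos
  obtain ⟨hη1, hη2⟩ := hη
  set j : ℂ := ((σ : ℤ) : ℂ) * Complex.I with hj
  have hjsq : j ^ 2 = -1 := by
    rcases Int.units_eq_one_or σ with h | h <;> simp [hj, h]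
  have hjre : j.re = 0 := by
    rcases Int.units_eq_one_or σ with h | h <;> simp [hj, h]
  have hj0 : j ≠ 0 := by intro h; rw [h] at hjsq; norm_num at hjsq
  set ν := j * l with hν
  have hν0 : ν ≠ 0 := mul_ne_zero hj0 hl
  have hνn : 0 < ‖ν‖ := norm_pos_iff.2 hν0
  have hdir : direction l σ = ν.arg := by rw [direction, hν, hj, mul_assoc]
  have hDσ := hD σ
  have hRσ := hR σ
  rw [hdir] at hDσ hRσ ⊢
  obtain ⟨βD, hβD, rD, hrD, ρD, hρD, LD, hLD, HD⟩ := hDσ.exists_scaledDomain hν0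
  obtain ⟨βR, hβR, rR, hrR, ρR, hρR, LR, hLR, HR⟩ := hRσ.exists_scaledDomain hν0
  -- The half-openings satisfy π/2 < η/2 < β < β₁ < π: the data live on β₁, the conjugacy on β.
  obtain ⟨β₁, hβ₁, hβ₁'⟩ := exists_between (lt_min (lt_min hβD hβR) (by linarith : η / 2 < Real.pi))
  have hβ₁D : β₁ ≤ βD := hβ₁'.le.trans ((min_le_left _ _).trans (min_le_left _ _))
  have hβ₁R : β₁ ≤ βR := hβ₁'.le.trans ((min_le_left _ _).trans (min_le_right _ _))
  have hβ₁π : β₁ < Real.pi := hβ₁'.trans_le (min_le_right _ _)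
  obtain ⟨β, hβ, hββ₁⟩ := exists_between hβ₁
  have hcos0 : 0 ≤ -Real.cos β := by
    have := Real.cos_nonpos_of_pi_div_two_le_of_le (by linarith : Real.pi / 2 ≤ β) (by linarith)
    linarith
  have hcos1 : -Real.cos β < -Real.cos β₁ := by
    have := Real.cos_lt_cos_of_nonneg_of_le_pi (by linarith : 0 ≤ β) hβ₁π.le hββ₁
    linarith
  have hcos2 : -Real.cos β₁ < 1 := by
    have := Real.cos_lt_cos_of_nonneg_of_le_pi (by linarith : 0 ≤ β₁) le_rfl hβ₁π
    rw [Real.cos_pi] at this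
    linarith
  obtain ⟨hDd, hDb⟩ := HD β₁ hβ₁D (by linarith) hβ₁π (min rD rR) (min_le_left _ _) (min ρD ρR)
    (min_le_left _ _)
  obtain ⟨hRd, hRb⟩ := HR β₁ hβ₁R (by linarith) hβ₁π (min rD rR) (min_le_right _ _) (min ρD ρR)
    (min_le_right _ _)
  obtain ⟨r₀, hr₀, ρ₀, hρ₀, χ₁, χ₂, hχ₁, hχ₂, he₁, he₂, C, hC, hχb⟩ :=
    exists_exponents (L := max LD LR) (n := n) hl hjsq hjre ha.le hcos0 hcos1 hcos2
      (lt_min hrD hrR) (lt_min hρD hρR) (hLD.trans (le_max_left _ _)) hc hc0 hDd hRd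
      (fun p hp => (hDb p hp).trans (by gcongr; exact le_max_left _ _))
      (fun p hp => (hRb p hp).trans (by gcongr; exact le_max_right _ _))
  rw [← hν] at hχ₁ hχ₂ he₁ he₂ hχb
  set γ := -Real.cos β with hγ
  have hr₀0 := hr₀.1
  set E := C * (‖ν‖ * r₀) ^ (n + 1) with hE
  have hE0 : 0 ≤ E := by positivity
  -- On the polydisc of radius 2ρ the fibre displacement is at most 8Eρ², so Cauchy's estimate gives
  -- the Lipschitz constant 16Eρ on radius ρ; 32Eρ ≤ 1 makes it at most 1/2.
  set ρ := min (ρ₀ / 2) (1 / (32 * (E + 1))) with hρ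
  have hρ0 : 0 < ρ := lt_min (by linarith [hρ₀.1]) (by positivity)
  have hρ2 : 2 * ρ ≤ ρ₀ := by linarith [min_le_left (ρ₀ / 2) (1 / (32 * (E + 1)))]
  have hρE : 32 * (E * ρ) ≤ 1 := by
    have h1 : (32 * (E + 1)) * ρ ≤ (32 * (E + 1)) * (1 / (32 * (E + 1))) := by
      gcongr
      exact min_le_right _ _
    rw [mul_one_div_cancel (by positivity)] at h1
    nlinarith
  have hsub2 : scaledDomain ν γ r₀ (2 * ρ) ⊆ scaledDomain ν γ r₀ ρ₀ :=
    scaledDomain_mono le_rfl le_rfl hρ2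
  have hsub1 : scaledDomain ν γ r₀ ρ ⊆ scaledDomain ν γ r₀ (2 * ρ) :=
    scaledDomain_mono le_rfl le_rfl (by linarith)
  have hbound : ∀ p ∈ scaledDomain ν γ r₀ (2 * ρ),
      ‖(expMap χ₁ χ₂ p).2 - p.2‖ ≤ 2 * C * ‖p.1‖ ^ (n + 1) * ‖p.2‖ ^ 2 := by
    intro p hp
    obtain ⟨h1, h2⟩ := hχb p (hsub2 hp)
    have h3 := (norm_fst_lt_of_mem_scaledDomain hν0 hp).le
    have h4 : ‖p.2‖ ≤ 2 * ρ := hp.2.le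
    have h5 : C * ‖p.1‖ ^ (n + 1) * ‖p.2‖ ≤ 1 := by
      calc C * ‖p.1‖ ^ (n + 1) * ‖p.2‖ ≤ C * (‖ν‖ * r₀) ^ (n + 1) * (2 * ρ) := by gcongr
        _ = 2 * (E * ρ) := by rw [hE]; ring
        _ ≤ 1 := by nlinarith [mul_nonneg hE0 hρ0.le]
    refine (norm_expMap_snd_sub_le h1 h2 h5).trans (le_of_eq ?_)
    ring
  have hdiff0 : DifferentiableOn ℂ (expMap χ₁ χ₂) (scaledDomain ν γ r₀ ρ₀) := by
    unfold expMap
    exact DifferentiableOn.prodMk (by fun_prop) (DifferentiableOn.prodMk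
      (DifferentiableOn.fun_mul (by fun_prop) hχ₁.cexp)
      (DifferentiableOn.fun_mul (by fun_prop) hχ₂.cexp))
  have hdiff := hdiff0.mono (hsub1.trans hsub2)
  obtain ⟨Ψ, hsrc, hcoe, hsymm⟩ := exists_openPartialHomeomorph (Ψ := expMap χ₁ χ₂)
    (isOpen_scaledDomain ν γ r₀ ρ) hdiff (fun p => rfl) (by
      rintro ⟨x, y⟩ hp ⟨x', z⟩ hq hxx
      change x = x' at hxx
      subst hxx
      have hmem : ∀ y ∈ ball (0 : ℂ × ℂ) (2 * ρ), ((x, y) : Phase) ∈ scaledDomain ν γ r₀ (2 * ρ) :=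
        fun y hy => ⟨hp.1, mem_ball_zero_iff.1 hy⟩
      have hx : ‖x‖ ≤ ‖ν‖ * r₀ := (norm_fst_lt_of_mem_scaledDomain hν0 hp).le
      have hlip := norm_sub_le_of_bounded (f := fun y : ℂ × ℂ => (expMap χ₁ χ₂ (x, y)).2 - y)
        (c := 0) (M := 8 * E * ρ ^ 2) hρ0 ?_ ?_
        (mem_closedBall_zero_iff.2 (show ‖y‖ ≤ ρ from hp.2.le))
        (mem_closedBall_zero_iff.2 (show ‖z‖ ≤ ρ from hq.2.le))
      · refine hlip.trans ?_
        refine mul_le_mul_of_nonneg_right ?_ (norm_nonneg _)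
        rw [div_le_iff₀ hρ0]
        nlinarith
      · have h1 : DifferentiableOn ℂ (fun y : ℂ × ℂ => expMap χ₁ χ₂ (x, y)) (ball 0 (2 * ρ)) :=
          (hdiff0.mono hsub2).comp (f := fun y : ℂ × ℂ => ((x, y) : Phase)) (by fun_prop) hmem
        exact h1.snd.fun_sub differentiableOn_id
      · intro w hw
        refine (hbound _ (hmem w hw)).trans ?_
        have h2 : ‖w‖ ≤ 2 * ρ := (mem_ball_zero_iff.1 hw).le
        calc 2 * C * ‖x‖ ^ (n + 1) * ‖w‖ ^ 2
            ≤ 2 * C * (‖ν‖ * r₀) ^ (n + 1) * (2 * ρ) ^ 2 := by gcongr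
          _ = 8 * E * ρ ^ 2 := by rw [hE]; ring)
  -- With ε = β − π/2 the sector has opening π + 2ε = 2β > η.
  have hsrc' : Ψ.source = wideSector l σ (‖ν‖ * r₀) (β - Real.pi / 2) ×ˢ polydisc ρ ρ := by
    rw [hsrc, wideSector, hdir]
    have h1 := sector_prod_polydisc (ρ := ρ) (r := ‖ν‖ * r₀) hν0 (by linarith : 0 < β)
      (by linarith)
    rw [mul_div_cancel_left₀ _ hνn.ne'] at h1
    rw [← h1]
    congr 2 <;> ring
  have hK : ∀ p ∈ Ψ.source, ‖(Ψ p).2 - p.2‖ ≤ 2 * E * ‖p.2‖ ^ 2 := by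
    intro p hp
    rw [hsrc] at hp
    rw [hcoe]
    refine (hbound p (hsub1 hp)).trans ?_
    have h3 := (norm_fst_lt_of_mem_scaledDomain hν0 hp).le
    calc 2 * C * ‖p.1‖ ^ (n + 1) * ‖p.2‖ ^ 2
        ≤ 2 * C * (‖ν‖ * r₀) ^ (n + 1) * ‖p.2‖ ^ 2 := by gcongr
      _ = _ := by rw [hE]; ring
  have hfst : ∀ p, (Ψ p).1 = p.1 := fun p => by rw [hcoe]; rfl
  have hx0 : ∀ p ∈ Ψ.source, p.1 ≠ 0 := by
    intro p hp h0
    rw [hsrc] at hp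
    have := hp.1.1
    simp [h0] at this
  refine ⟨Ψ, ⟨⟨Ψ.open_source, ‖ν‖ * r₀, by positivity, ρ, hρ0, ρ, hρ0, β - η / 2, by linarith, ?_⟩,
    ?_, hsymm, fun p _ => hfst p, ?_⟩, ?_, ⟨_, hK⟩, ‖ν‖ * r₀, by positivity, β - Real.pi / 2,
    ⟨by linarith, by linarith⟩, by linarith, ρ, hρ0, ρ, hρ0,
    fun p => (p.1 ^ (n + 1))⁻¹ • ((Ψ p).2 - p.2), 2 * C, hsrc', ?_, ?_, ?_⟩
  · rw [hsrc', wideSector, hdir]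
    exact Set.prod_mono (sector_mono le_rfl (by linarith) (by linarith)) subset_rfl
  · rw [hcoe, hsrc]
    exact hdiff
  · refine Asymptotics.IsBigO.of_bound (2 * E) ?_
    filter_upwards [self_mem_nhdsWithin] with p hp
    have h1 : ‖Ψ p - p‖ = ‖(Ψ p).2 - p.2‖ := by
      rw [Prod.norm_def, Prod.fst_sub, hfst, sub_self, norm_zero, Prod.snd_sub]
      exact max_eq_right (norm_nonneg _)
    rw [h1, norm_pow, norm_norm]
    refine (hK p hp).trans ?_
    gcongr
    exact norm_snd_le p
  · intro q hq
    have hp : Ψ.symm q ∈ Ψ.source := Ψ.map_target hq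
    have hq' : q = Ψ (Ψ.symm q) := (Ψ.right_inv hq).symm
    rw [pushforward]
    nth_rewrite 3 [hq']
    generalize Ψ.symm q = p at hp
    rw [hsrc] at hp
    have hp0 := hsub2 (hsub1 hp)
    have hnh := (isOpen_scaledDomain ν γ r₀ ρ₀).mem_nhds hp0
    rw [hcoe, fderiv_expMap_apply (hχ₁.differentiableAt hnh) (hχ₂.differentiableAt hnh),
      he₁ p hp0, he₂ p hp0]
    have hv : p.2.1 * Complex.exp (χ₁ p) * (p.2.2 * Complex.exp (χ₂ p)) =
        p.2.1 * p.2.2 * Complex.exp (χ₁ p + χ₂ p) := by rw [Complex.exp_add]; ring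
    simp only [normalForm, expMap, hv, normalizedUpTo, fieldY₀, fieldC, fieldR, Prod.smul_mk,
      Prod.mk_add_mk, smul_eq_mul]
    refine Prod.ext ?_ (Prod.ext ?_ ?_) <;> simp only <;> ring
  · rw [hcoe, hsrc]
    rw [hsrc] at hx0
    have h1 : DifferentiableOn ℂ (fun p : Phase => (p.1 ^ (n + 1))⁻¹) (scaledDomain ν γ r₀ ρ) :=
      DifferentiableOn.fun_inv (by fun_prop) fun p hp => pow_ne_zero _ (hx0 p hp)
    exact h1.fun_smul (hdiff.snd.fun_sub differentiableOn_snd)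
  · intro p hp
    refine Prod.ext ?_ ?_
    · simp [hfst]
    · simp only [Prod.snd_add, Prod.smul_snd]
      rw [smul_smul, mul_inv_cancel₀ (pow_ne_zero _ (hx0 p hp)), one_smul, add_sub_cancel]
  · intro p hp
    have hpos : 0 < ‖p.1‖ ^ (n + 1) := pow_pos (norm_pos_iff.2 (hx0 p hp)) _
    rw [norm_smul, norm_inv, norm_pow, inv_mul_le_iff₀ hpos]
    have hp' := hp
    rw [hsrc] at hp'
    have := hbound p (hsub1 hp')
    rw [hcoe]
    refine this.trans (le_of_eq ?_)
    ring
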